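/- Let $a,b>0$ and $m\in\mathbb R$, and let $X_1,X_2,\dots$ be i.i.d. random variables with the symmetric variance-gamma distribution with parameters $(m,a,b)$, i.e. with the law of $m+\sqrt{bG}\,Z$, where $G\sim\Gamma(a,1)$ and $Z\sim\mathcal N(0,1)$ are independent. Let $$L(x)=\tfrac12\ln(\pi/2)+\tfrac12\ln x+\ln\Gamma(x)-\ln\Gamma(x+\tfrac12),\qquad x>0,$$ let $\ell:(\tfrac12\ln(\pi/2),\infty)\to(0,\infty)$ be the inverse of $L$ (extended by an arbitrary fixed constant outside its domain), and put $$\Psi(x,y)=\Big(\ell(\tfrac12\ln y-\ln x),\ \frac{y}{\ell(\tfrac12\ln y-\ln x)}\Big).$$ For unknown location $m$ define $$\overline X=\frac1N\sum_{k=1}^N X_k,\quad \hat A=\frac1N\sum_{k=1}^N|X_k-\overline X|,\quad \hat V=\frac1N\sum_{k=1}^N(X_k-\overline X)^2,\quad (\hat a,\hat b)=\Psi(\hat A,\hat V).$$ For known location define $$\hat A'=\frac1N\sum_{k=1}^N|X_k-m|,\quad \hat V'=\frac1N\sum_{k=1}^N(X_k-m)^2,\quad (\hat a',\hat b')=\Psi(\hat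 A',\hat V').$$ Then: (i) Almost surely, $\tfrac12\ln\hat V-\ln\hat A>\tfrac12\ln(\pi/2)$ for all sufficiently large $N$ (so that the estimators are well defined), and $(\overline X,\hat a,\hat b)\to(m,a,b)$ as $N\to\infty$. (ii) As $N\to\infty$, $$\sqrt N\,(\overline X-m,\ \hat a-a,\ \hat b-b)\to_d\mathcal N_3\big(0,\operatorname{diag}(ab,\Sigma)\big),$$ where $\Sigma$ is the limiting $2\times2$ covariance matrix of the estimators for known location, that is, $$\sqrt N\,(\hat a'-a,\ \hat b'-b)\to_d\mathcal N_2(0,\Sigma).$$ Explicitly, $\Sigma=JCJ^{T}$ is positive semidefinite, where $C$ is the covariance matrix of $(|X_1-m|,(X_1-m)^2)$ and $J$ is the Jacobi matrix of $\Psi$ at $(A,V)=(\mathbb E|X_1-m|,\operatorname{Var}X_1)$. -/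

import Mathlib

open MeasureTheory ProbabilityTheory Filter Topology

noncomputable section

namespace SVG

/-- The symmetric variance-gamma (generalized Laplace) distribution with location `m`, shape `a`
and scale `b`: the law of `m + √(b G) Z` with independent `G ∼ Γ(a, 1)` and `Z ∼ N(0, 1)`. -/
def law (m a b : ℝ) : Measure ℝ :=
  ((gammaMeasure a 1).prod (gaussianReal 0 1)).map (fun p => m + Real.sqrt (b * p.1) * p.2)

/-- The function `L`. -/
def L (x : ℝ) : ℝ :=
  1 / 2 * Real.log (Real.pi / 2) + 1 / 2 * Real.log x + Real.log (Real.Gamma x)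
    - Real.log (Real.Gamma (x + 1 / 2))

/-- The inverse `ℓ` of `L` on `(0, ∞)`. Off the image `L '' (0, ∞)`, where there is no inverse,
it is an unspecified constant. -/
def ell (y : ℝ) : ℝ := Function.invFunOn L (Set.Ioi 0) y

/-- The statistic `(1/2) ln V - ln A`, to which `ℓ` is applied. -/
def logRatio (A V : ℝ) : ℝ := 1 / 2 * Real.log V - Real.log A

/-- First coordinate of the map `Ψ(A, V) = (a, b)`. -/
def shape (A V : ℝ) : ℝ := ell (logRatio A V)

/-- Second coordinate of the map `Ψ(A, V) = (a, b)`. -/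
def scale (A V : ℝ) : ℝ := V / shape A V

/-- The sample mean of `x 0, …, x (N - 1)`. -/
def mean (N : ℕ) (x : ℕ → ℝ) : ℝ := (∑ k ∈ Finset.range N, x k) / N

/-- The sample, centered by its own mean. -/
def center (N : ℕ) (x : ℕ → ℝ) : ℕ → ℝ := fun k => x k - mean N x

/-- The first empirical absolute moment (without centering). -/
def absMoment (N : ℕ) (x : ℕ → ℝ) : ℝ := mean N (fun k => |x k|)

/-- The second empirical moment (without centering). -/
def sqMoment (N : ℕ) (x : ℕ → ℝ) : ℝ := mean N (fun k => x k ^ 2)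

/-- The shape estimator for a sample whose location is known to be zero. -/
def aHat' (N : ℕ) (x : ℕ → ℝ) : ℝ := shape (absMoment N x) (sqMoment N x)

/-- The scale estimator for a sample whose location is known to be zero. -/
def bHat' (N : ℕ) (x : ℕ → ℝ) : ℝ := scale (absMoment N x) (sqMoment N x)

/-- The empirical mean absolute deviation `Â`. -/
def madHat (N : ℕ) (x : ℕ → ℝ) : ℝ := absMoment N (center N x)

/-- The empirical variance `V̂`. -/
def varHat (N : ℕ) (x : ℕ → ℝ) : ℝ := sqMoment N (center N x)

/-- The shape estimator `â` for unknown location. -/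
def aHat (N : ℕ) (x : ℕ → ℝ) : ℝ := shape (madHat N x) (varHat N x)

/-- The scale estimator `b̂` for unknown location. -/
def bHat (N : ℕ) (x : ℕ → ℝ) : ℝ := scale (madHat N x) (varHat N x)

/-- The first absolute centered moment `A` of the distribution. -/
def A (a b : ℝ) : ℝ := ∫ x, |x| ∂(law 0 a b)

/-- The variance `V` of the distribution. -/
def V (a b : ℝ) : ℝ := ∫ x, x ^ 2 ∂(law 0 a b)

/-- The covariance matrix of `(|X|, X ^ 2)` for `X` with the centered distribution. -/
def momentCov (a b : ℝ) : Matrix (Fin 2) (Fin 2) ℝ :=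
  Matrix.of fun i j =>
    covariance (fun x : ℝ => ![|x|, x ^ 2] i) (fun x : ℝ => ![|x|, x ^ 2] j) (law 0 a b)

/-- The Jacobi matrix of `Ψ` at `(A, V)`. -/
def jacobian (a b : ℝ) : Matrix (Fin 2) (Fin 2) ℝ :=
  !![deriv (fun x => shape x (V a b)) (A a b), deriv (fun y => shape (A a b) y) (V a b);
     deriv (fun x => scale x (V a b)) (A a b), deriv (fun y => scale (A a b) y) (V a b)]

/-- The limiting covariance matrix `Σ` of the estimators of `(a, b)` for known location. -/
def limitCov (a b : ℝ) : Matrix (Fin 2) (Fin 2) ℝ :=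
  jacobian a b * momentCov a b * (jacobian a b).transpose

/-- The block diagonal matrix `diag(v, S)`. -/
def blockDiag (v : ℝ) (S : Matrix (Fin 2) (Fin 2) ℝ) : Matrix (Fin 3) (Fin 3) ℝ :=
  !![v, 0, 0;
     0, S 0 0, S 0 1;
     0, S 1 0, S 1 1]

end SVG

end

/-! Since `√(bG)` and `Z` are independent, absolute moments factor: `E|X|^n = b^{n/2} Γ(a +
n/2)/Γ(a) E|Z|^n` for `m = 0`. In `½ ln V - ln A` the scale cancels and exactly `L a` remains, so
`Ψ(A, V) = (a, b)`. The recursion `L x = decL x + L (x + 1)` and `L → infL` at infinity exhibit `L -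
infL` as a sum of translates of the decreasing function `decL`; hence `L` decreases strictly from
`∞` to `infL` with nonvanishing derivative, and `ell` is differentiable. Consistency then follows
from the strong law and continuity.

For normality, `Ψ` is linearized at `(A, V)` by the delta method, and the multivariate central limit
theorem is applied to the linear part. For unknown location the point is that centering by the
sample mean costs only `o(N^{-1/2})` in probability. For the variance the cost is the squared mean.
For the absolute moment, `|y - t| - |y| = -t sign y` up to an error supported on `|y| ≤ |t|`
(`abs_abs_sub_sub_abs_add_le`); with `t = O(N^{-1/2})`, the signs average to zero by symmetry and
the fraction of observations near zero vanishes because the law has no atom there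
(`negligible_sqrt_mul_madHat_sub`). So both pairs of estimators have the same linearization, an even
function of the observation; it is uncorrelated with the odd function `x` that gives the sample
mean, whence the block diagonal limit. -/

namespace SVG

/-! ### The function `L` and its inverse -/

/-- The lower limit `(1/2) ln (π/2)` of the function `L`. -/
noncomputable def infL : ℝ := 1 / 2 * Real.log (Real.pi / 2)

/-- The decrement `L x - L (x + 1)`. -/
noncomputable def decL (x : ℝ) : ℝ :=
  Real.log (x + 1 / 2) - 1 / 2 * Real.log x - 1 / 2 * Real.log (x + 1)

lemma log_Gamma_add_one {x : ℝ} (hx : 0 < x) :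
    Real.log (Real.Gamma (x + 1)) = Real.log x + Real.log (Real.Gamma x) := by
  rw [Real.Gamma_add_one hx.ne', Real.log_mul hx.ne' (Real.Gamma_pos_of_pos hx).ne']

lemma L_eq_decL_add {x : ℝ} (hx : 0 < x) : L x = decL x + L (x + 1) := by
  have h1 := log_Gamma_add_one hx
  have h2 := log_Gamma_add_one (x := x + 1 / 2) (by linarith)
  have e : x + 1 + 1 / 2 = x + 1 / 2 + 1 := by ring
  unfold L decL
  rw [e, h1, h2]
  ring

/-- Midpoint convexity of `log Γ` between `x` and `x + 1`. Used at `x` and at `x + 1/2`, it squeezes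
`L` from both sides. -/
lemma two_mul_log_Gamma_add_half_le {x : ℝ} (hx : 0 < x) :
    2 * Real.log (Real.Gamma (x + 1 / 2)) ≤ 2 * Real.log (Real.Gamma x) + Real.log x := by
  have hx1 : x + 1 ∈ Set.Ioi (0 : ℝ) := Set.mem_Ioi.2 (by linarith)
  have h := Real.convexOn_log_Gamma.2 (Set.mem_Ioi.2 hx) hx1
    (show (0 : ℝ) ≤ 1 / 2 by norm_num) (show (0 : ℝ) ≤ 1 / 2 by norm_num) (by norm_num)
  have e : (1 / 2 : ℝ) * x + 1 / 2 * (x + 1) = x + 1 / 2 := by ring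
  simp only [smul_eq_mul, Function.comp_apply] at h
  rw [e, log_Gamma_add_one hx] at h
  linarith

lemma infL_le_L {x : ℝ} (hx : 0 < x) : infL ≤ L x := by
  have := two_mul_log_Gamma_add_half_le hx
  unfold infL L
  linarith

lemma L_le {x : ℝ} (hx : 0 < x) :
    L x ≤ infL + 1 / 2 * (Real.log (x + 1 / 2) - Real.log x) := by
  have := two_mul_log_Gamma_add_half_le (x := x + 1 / 2) (by linarith)
  have e : x + 1 / 2 + 1 / 2 = x + 1 := by ring
  rw [e, log_Gamma_add_one hx] at this
  unfold infL L
  linarith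

lemma tendsto_L_atTop : Tendsto L atTop (𝓝 infL) := by
  have h : Tendsto (fun x : ℝ => infL + 1 / 2 * (Real.log (x + 1 / 2) - Real.log x)) atTop
      (𝓝 (infL + 1 / 2 * 0)) := by
    refine tendsto_const_nhds.add (Tendsto.const_mul _ ?_)
    exact Real.tendsto_log_comp_add_sub_log (1 / 2)
  rw [mul_zero, add_zero] at h
  refine tendsto_of_tendsto_of_tendsto_of_le_of_le' tendsto_const_nhds h ?_ ?_
  · filter_upwards [eventually_gt_atTop 0] with x hx using infL_le_L hx
  · filter_upwards [eventually_gt_atTop 0] with x hx using L_le hx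

lemma hasDerivAt_decL {x : ℝ} (hx : 0 < x) :
    HasDerivAt decL (1 / (x + 1 / 2) - 1 / 2 * x⁻¹ - 1 / 2 * (1 / (x + 1))) x := by
  have h1 := ((hasDerivAt_id x).add_const (1 / 2 : ℝ)).log (by simp; linarith)
  have h2 := ((hasDerivAt_id x).add_const (1 : ℝ)).log (by simp; linarith)
  exact (h1.sub ((Real.hasDerivAt_log hx.ne').const_mul _)).sub (h2.const_mul _)

lemma deriv_decL_neg {x : ℝ} (hx : 0 < x) :
    1 / (x + 1 / 2) - 1 / 2 * x⁻¹ - 1 / 2 * (1 / (x + 1)) < 0 := by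
  have e : 1 / (x + 1 / 2) - 1 / 2 * x⁻¹ - 1 / 2 * (1 / (x + 1))
      = - (1 / (4 * x * (x + 1 / 2) * (x + 1))) := by
    field_simp
    ring
  rw [e, neg_lt_zero]
  positivity

lemma strictAntiOn_decL : StrictAntiOn decL (Set.Ioi 0) := by
  refine strictAntiOn_of_deriv_neg (convex_Ioi 0)
    (fun x hx => (hasDerivAt_decL hx).continuousAt.continuousWithinAt) fun x hx => ?_
  rw [interior_Ioi] at hx
  rw [(hasDerivAt_decL hx).deriv]
  exact deriv_decL_neg hx

lemma L_eq_sum_decL_add {x : ℝ} (hx : 0 < x) (n : ℕ) :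
    L x = ∑ k ∈ Finset.range n, decL (x + k) + L (x + n) := by
  induction n with
  | zero => simp
  | succ n ih =>
    rw [Finset.sum_range_succ, ih, L_eq_decL_add (x := x + n) (by positivity)]
    push_cast
    rw [← add_assoc x]
    ring

lemma tendsto_L_add_natCast (x : ℝ) : Tendsto (fun n : ℕ => L (x + n)) atTop (𝓝 infL) :=
  tendsto_L_atTop.comp (tendsto_atTop_add_const_left _ x tendsto_natCast_atTop_atTop)

/-- By telescoping, `L x - L y` is the sum of all `decL (x + k) - decL (y + k)`, which are
nonnegative; only the term `k = 0` is kept. Equivalently, `L - decL` is antitone. -/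
lemma decL_sub_le_L_sub {x y : ℝ} (hx : 0 < x) (hxy : x ≤ y) :
    decL x - decL y ≤ L x - L y := by
  have hy := hx.trans_le hxy
  have ht : Tendsto (fun n : ℕ => decL x - decL y + (L (x + n) - L (y + n))) atTop
      (𝓝 (decL x - decL y + (infL - infL))) :=
    tendsto_const_nhds.add ((tendsto_L_add_natCast x).sub (tendsto_L_add_natCast y))
  rw [sub_self, add_zero] at ht
  refine le_of_tendsto ht ?_
  filter_upwards [eventually_ge_atTop 1] with n hn
  obtain ⟨k, rfl⟩ := Nat.exists_eq_add_of_le' hn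
  have hs : ∑ i ∈ Finset.range k, decL (y + ((i + 1 : ℕ) : ℝ))
      ≤ ∑ i ∈ Finset.range k, decL (x + ((i + 1 : ℕ) : ℝ)) := by
    refine Finset.sum_le_sum fun i _ => strictAntiOn_decL.antitoneOn ?_ ?_ (by linarith)
    · exact Set.mem_Ioi.2 (by positivity)
    · exact Set.mem_Ioi.2 (by positivity)
  have ex := L_eq_sum_decL_add hx (k + 1)
  have ey := L_eq_sum_decL_add hy (k + 1)
  rw [Finset.sum_range_succ'] at ex ey
  simp only [Nat.cast_zero, add_zero] at ex ey
  linarith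

lemma strictAntiOn_L : StrictAntiOn L (Set.Ioi 0) := fun x hx y hy hxy => by
  have h1 := decL_sub_le_L_sub (x := x) hx hxy.le
  have h2 := strictAntiOn_decL hx hy hxy
  linarith

lemma differentiableAt_Gamma_of_pos {x : ℝ} (hx : 0 < x) : DifferentiableAt ℝ Real.Gamma x :=
  Real.differentiableOn_Gamma_Ioi.differentiableAt (Ioi_mem_nhds hx)

lemma differentiableAt_L {x : ℝ} (hx : 0 < x) : DifferentiableAt ℝ L x := by
  have h1 := (differentiableAt_Gamma_of_pos hx).log (Real.Gamma_pos_of_pos hx).ne'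
  have hx' : 0 < x + 1 / 2 := by linarith
  have h2 : DifferentiableAt ℝ (fun y : ℝ => Real.log (Real.Gamma (y + 1 / 2))) x :=
    ((differentiableAt_Gamma_of_pos hx').comp x (f := fun y : ℝ => y + 1 / 2)
      (by fun_prop)).log (Real.Gamma_pos_of_pos hx').ne'
  unfold L
  have := Real.differentiableAt_log hx.ne'
  fun_prop

/-- Strict monotonicity alone would allow a zero derivative. Since `L - decL` is antitone, `L'` is
at most the negative derivative of `decL`. -/
lemma deriv_L_neg {x : ℝ} (hx : 0 < x) : deriv L x < 0 := by
  have hD : HasDerivAt (fun y => L y - decL y)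
      (deriv L x - (1 / (x + 1 / 2) - 1 / 2 * x⁻¹ - 1 / 2 * (1 / (x + 1)))) x :=
    (differentiableAt_L hx).hasDerivAt.sub (hasDerivAt_decL hx)
  have hA : AntitoneOn (fun y => L y - decL y) (Set.Ioi 0) := fun u hu v hv huv => by
    have := decL_sub_le_L_sub hu huv
    simp only
    linarith
  have h0 : deriv L x - (1 / (x + 1 / 2) - 1 / 2 * x⁻¹ - 1 / 2 * (1 / (x + 1))) ≤ 0 := by
    rw [← hD.deriv, ← derivWithin_of_mem_nhds (Ioi_mem_nhds hx)]
    exact hA.derivWithin_nonpos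
  linarith [deriv_decL_neg hx]

lemma infL_lt_L {x : ℝ} (hx : 0 < x) : infL < L x :=
  (infL_le_L (x := x + 1) (by linarith)).trans_lt
    (strictAntiOn_L hx (Set.mem_Ioi.2 (by linarith)) (by linarith))

/-- `L x ≥ decL x + infL`, and the only singular term of `decL` at zero is `-½ log x`. -/
lemma tendsto_L_nhdsGT_zero : Tendsto L (𝓝[>] 0) atTop := by
  have h : Tendsto (fun x : ℝ => Real.log (x + 1 / 2) - 1 / 2 * Real.log (x + 1) + infL
      + 1 / 2 * (-Real.log x)) (𝓝[>] 0) atTop := by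
    have hc : ContinuousAt (fun x : ℝ => Real.log (x + 1 / 2) - 1 / 2 * Real.log (x + 1) + infL)
        0 := by
      have h1 : ContinuousAt (fun x : ℝ => Real.log (x + 1 / 2)) 0 :=
        ContinuousAt.log (by fun_prop) (by norm_num)
      have h2 : ContinuousAt (fun x : ℝ => Real.log (x + 1)) 0 :=
        ContinuousAt.log (by fun_prop) (by norm_num)
      fun_prop
    refine (hc.tendsto.mono_left nhdsWithin_le_nhds).add_atTop ?_
    exact (tendsto_neg_atBot_atTop.comp Real.tendsto_log_nhdsGT_zero).const_mul_atTop
      (by norm_num)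
  refine tendsto_atTop_mono' _ ?_ h
  filter_upwards [self_mem_nhdsWithin] with x hx
  rw [L_eq_decL_add hx]
  have := infL_le_L (x := x + 1) (by have : (0 : ℝ) < x := hx; linarith)
  unfold decL
  linarith

lemma continuousOn_L : ContinuousOn L (Set.Ioi 0) := fun _ hx =>
  (differentiableAt_L hx).continuousAt.continuousWithinAt

lemma image_L : L '' Set.Ioi 0 = Set.Ioi infL := by
  refine Set.Subset.antisymm (Set.image_subset_iff.2 fun x hx => infL_lt_L hx) fun y hy => ?_
  obtain ⟨u, hu0, hu⟩ : ∃ u, 0 < u ∧ y < L u := by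
    have := (tendsto_L_nhdsGT_zero.eventually_gt_atTop y).and self_mem_nhdsWithin
    obtain ⟨u, h1, h2⟩ := this.exists
    exact ⟨u, h2, h1⟩
  obtain ⟨v, hv, hv0⟩ :=
    ((tendsto_L_atTop.eventually_lt_const hy).and (eventually_gt_atTop 0)).exists
  exact (isPreconnected_Ioi.intermediate_value (Set.mem_Ioi.2 hv0) (Set.mem_Ioi.2 hu0)
    continuousOn_L) ⟨hv.le, hu.le⟩

lemma ell_L {x : ℝ} (hx : 0 < x) : ell (L x) = x :=
  strictAntiOn_L.injOn.leftInvOn_invFunOn hx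

lemma ell_pos {y : ℝ} (hy : infL < y) : 0 < ell y :=
  Function.invFunOn_mem (by rw [← Set.mem_Ioi, ← image_L] at hy; exact hy)

lemma L_ell {y : ℝ} (hy : infL < y) : L (ell y) = y :=
  Function.invFunOn_eq (by rw [← Set.mem_Ioi, ← image_L] at hy; exact hy)

lemma strictAntiOn_ell : StrictAntiOn ell (Set.Ioi infL) := fun x hx y hy hxy => by
  by_contra! h
  have := strictAntiOn_L.antitoneOn (ell_pos hx) (ell_pos hy) h
  rw [L_ell hx, L_ell hy] at this
  linarith

/-- A strictly monotone function whose image is a neighbourhood of the value is continuous there;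
the sign change turns `ell` into an increasing function. -/
lemma continuousAt_ell {y : ℝ} (hy : infL < y) : ContinuousAt ell y := by
  have hm : StrictMonoOn (fun z => -ell z) (Set.Ioi infL) := fun u hu v hv huv =>
    neg_lt_neg (strictAntiOn_ell hu hv huv)
  have hi : (fun z => -ell z) '' Set.Ioi infL = Set.Iio 0 := by
    ext z
    constructor
    · rintro ⟨u, hu, rfl⟩
      simpa using ell_pos hu
    · intro hz
      have hz' : 0 < -z := by simpa using hz
      exact ⟨L (-z), infL_lt_L hz', by simp [ell_L hz']⟩
  have : ContinuousAt (fun z => -ell z) y := by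
    refine hm.continuousAt_of_image_mem_nhds (Ioi_mem_nhds hy) ?_
    rw [hi]
    exact Iio_mem_nhds (by simpa using ell_pos hy)
  simpa only [neg_neg] using this.fun_neg

lemma hasDerivAt_ell {y : ℝ} (hy : infL < y) : HasDerivAt ell (deriv L (ell y))⁻¹ y :=
  HasDerivAt.of_local_left_inverse (continuousAt_ell hy)
    (differentiableAt_L (ell_pos hy)).hasDerivAt (deriv_L_neg (ell_pos hy)).ne
    (by filter_upwards [Ioi_mem_nhds hy] with z hz using L_ell hz)

lemma measurable_ell : Measurable ell := by
  have hc : ∀ y ∈ (Set.Ioi infL)ᶜ, ell y = ell infL := by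
    -- Where no preimage exists, `Function.invFunOn` returns one fixed default value.
    have key : ∀ y ∈ (Set.Ioi infL)ᶜ, ell y = Classical.choice (⟨0⟩ : Nonempty ℝ) := by
      intro y hy
      refine Function.invFunOn_neg ?_
      rintro h
      exact hy (image_L ▸ h)
    intro y hy
    rw [key y hy, key infL (by simp)]
  have h1 : Measurable ((Set.Ioi infL).domRestrict ell) :=
    (continuousOn_iff_continuous_domRestrict.1
      fun y hy => (continuousAt_ell hy).continuousWithinAt).measurable
  have h2 : Measurable ((Set.Ioi infL)ᶜ.domRestrict ell) := by
    have : (Set.Ioi infL)ᶜ.domRestrict ell = fun _ => ell infL := by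
      ext ⟨y, hy⟩
      exact hc y hy
    rw [this]
    exact measurable_const
  exact measurable_of_restrict_of_restrict_compl measurableSet_Ioi h1 h2

lemma measurable_shape : Measurable (Function.uncurry shape) := by
  unfold shape logRatio
  exact measurable_ell.comp (by fun_prop)

lemma measurable_scale : Measurable (Function.uncurry scale) :=
  measurable_snd.div measurable_shape

/-! ### Absolute moments of the Gamma and Gaussian laws -/

section Gamma

variable {a : ℝ}

/-- The factor `x^{n/2}` shifts the shape to `a + n/2`, so moments become Gamma integrals. The point
`0`, where the two sides may differ, is discarded. -/
lemma gammaPDFReal_mul_sqrt_pow_ae (a : ℝ) (n : ℕ) :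
    (fun x => gammaPDFReal a 1 x * √x ^ n) =ᵐ[volume]
      (Set.Ioi (0 : ℝ)).indicator
        fun x => (Real.Gamma a)⁻¹ * (Real.exp (-x) * x ^ (a + n / 2 - 1)) := by
  filter_upwards [compl_mem_ae_iff.2 (measure_singleton (0 : ℝ))] with x hx
  rcases lt_or_gt_of_ne (show x ≠ 0 from hx) with h | h
  · rw [Set.indicator_of_notMem (by simpa using h.le)]
    simp [gammaPDFReal, not_le.2 h]
  · rw [Set.indicator_of_mem (Set.mem_Ioi.2 h), gammaPDFReal, if_pos h.le, Real.one_rpow,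
      one_mul, Real.sqrt_eq_rpow, ← Real.rpow_mul_natCast h.le,
      show a + n / 2 - 1 = (a - 1) + 1 / 2 * n by ring, Real.rpow_add h]
    ring

lemma gammaMeasure_eq_withDensity_ofReal (a : ℝ) :
    gammaMeasure a 1 = volume.withDensity fun x => ENNReal.ofReal (gammaPDFReal a 1 x) := rfl

lemma integrable_sqrt_pow_gammaMeasure (ha : 0 < a) (n : ℕ) :
    Integrable (fun x => √x ^ n) (gammaMeasure a 1) := by
  rw [gammaMeasure_eq_withDensity_ofReal,
    integrable_withDensity_iff_integrable_smul' (by fun_prop) (by simp)]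
  have h : Integrable ((Set.Ioi (0 : ℝ)).indicator
      fun x => (Real.Gamma a)⁻¹ * (Real.exp (-x) * x ^ (a + n / 2 - 1))) :=
    (integrable_indicator_iff measurableSet_Ioi).2
      ((Real.GammaIntegral_convergent (s := a + n / 2) (by positivity)).const_mul _)
  refine h.congr ?_
  filter_upwards [gammaPDFReal_mul_sqrt_pow_ae a n] with x hx
  rw [← hx, ENNReal.toReal_ofReal (gammaPDFReal_nonneg ha one_pos x), smul_eq_mul]

lemma integral_sqrt_pow_gammaMeasure (ha : 0 < a) (n : ℕ) :
    ∫ x, √x ^ n ∂(gammaMeasure a 1) = Real.Gamma (a + n / 2) / Real.Gamma a := by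
  rw [gammaMeasure_eq_withDensity_ofReal,
    integral_withDensity_eq_integral_toReal_smul (by fun_prop) (by simp)]
  simp_rw [fun x => ENNReal.toReal_ofReal (gammaPDFReal_nonneg ha one_pos x), smul_eq_mul]
  rw [integral_congr_ae (gammaPDFReal_mul_sqrt_pow_ae a n), integral_indicator measurableSet_Ioi,
    integral_const_mul, ← Real.Gamma_eq_integral (by positivity), inv_mul_eq_div]

lemma gammaMeasure_ae_pos (a : ℝ) : ∀ᵐ x ∂(gammaMeasure a 1), 0 < x := by
  have h : gammaMeasure a 1 (Set.Iic 0) = 0 := by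
    rw [gammaMeasure, withDensity_apply _ measurableSet_Iic, ← setLIntegral_congr Iio_ae_eq_Iic]
    exact lintegral_gammaPDF_of_nonpos le_rfl
  rw [ae_iff]
  convert h using 2
  ext x
  simp

end Gamma

lemma integrable_abs_pow_gaussianReal (n : ℕ) :
    Integrable (fun x : ℝ => |x| ^ n) (gaussianReal 0 1) := by
  have := (memLp_id_gaussianReal' (μ := 0) (v := 1) (n : ENNReal) (by simp)).integrable_norm_pow'
  simpa using this

lemma integral_abs_gaussianReal : ∫ x, |x| ∂(gaussianReal 0 1) = √(2 / Real.pi) := by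
  rw [integral_gaussianReal_eq_integral_smul (by norm_num)]
  -- As a function of `|x|`, the integrand has twice its half-line integral, which is a Gamma
  -- integral.
  have e : ∀ x : ℝ, gaussianPDFReal 0 1 x • |x| =
      (fun y => (√(2 * Real.pi))⁻¹ * (y ^ (1 : ℝ) * Real.exp (-(1 / 2) * y ^ (2 : ℝ)))) |x| := by
    intro x
    simp only [gaussianPDFReal, NNReal.coe_one, mul_one, sub_zero, smul_eq_mul, Real.rpow_one,
      Real.rpow_two, sq_abs]
    rw [show -x ^ 2 / 2 = -(1 / 2) * x ^ 2 by ring]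
    ring
  simp_rw [e]
  rw [integral_comp_abs (f := fun y => (√(2 * Real.pi))⁻¹ *
    (y ^ (1 : ℝ) * Real.exp (-(1 / 2) * y ^ (2 : ℝ)))), integral_const_mul,
    integral_rpow_mul_exp_neg_mul_rpow (by norm_num) (by norm_num) (by norm_num)]
  norm_num
  have h2 : √2 * √2 = 2 := Real.mul_self_sqrt (by norm_num)
  have hp : 0 < √Real.pi := Real.sqrt_pos.2 Real.pi_pos
  field_simp
  nlinarith [h2]

lemma integral_sq_gaussianReal : ∫ x, x ^ 2 ∂(gaussianReal 0 1) = 1 := by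
  have h := variance_id_gaussianReal (μ := 0) (v := 1)
  rw [variance_of_integral_eq_zero (by fun_prop) (by simp)] at h
  simpa using h

/-! ### The centered variance-gamma law and the map `Ψ` -/

section Law

variable {a b : ℝ}

lemma isProbabilityMeasure_law (m b : ℝ) (ha : 0 < a) : IsProbabilityMeasure (law m a b) := by
  have := isProbabilityMeasure_gammaMeasure ha one_pos
  exact Measure.isProbabilityMeasure_map (by fun_prop)

lemma law_zero_eq (a b : ℝ) : law 0 a b =
    ((gammaMeasure a 1).prod (gaussianReal 0 1)).map (fun p => √(b * p.1) * p.2) := by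
  simp [law]

lemma law_map_sub (m a b : ℝ) : (law m a b).map (fun x => x - m) = law 0 a b := by
  rw [law, Measure.map_map (by fun_prop) (by fun_prop), law_zero_eq]
  congr 1
  ext p
  simp

lemma abs_sqrt_mul_pow (hb : 0 < b) (n : ℕ) (g z : ℝ) :
    |√(b * g) * z| ^ n = √b ^ n * (√g ^ n * |z| ^ n) := by
  rw [abs_mul, abs_of_nonneg (Real.sqrt_nonneg _), Real.sqrt_mul hb.le]
  ring

lemma integrable_abs_pow_law (ha : 0 < a) (hb : 0 < b) (n : ℕ) :
    Integrable (fun x => |x| ^ n) (law 0 a b) := by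
  have := isProbabilityMeasure_gammaMeasure ha one_pos
  rw [law_zero_eq, integrable_map_measure (by fun_prop) (by fun_prop)]
  simp only [Function.comp_def, abs_sqrt_mul_pow hb]
  exact ((integrable_sqrt_pow_gammaMeasure ha n).mul_prod
    (integrable_abs_pow_gaussianReal n)).const_mul _

lemma integral_abs_pow_law (ha : 0 < a) (hb : 0 < b) (n : ℕ) :
    ∫ x, |x| ^ n ∂(law 0 a b) =
      √b ^ n * (Real.Gamma (a + n / 2) / Real.Gamma a * ∫ x, |x| ^ n ∂(gaussianReal 0 1)) := by
  have := isProbabilityMeasure_gammaMeasure ha one_pos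
  rw [law_zero_eq, integral_map (by fun_prop) (by fun_prop)]
  simp only [abs_sqrt_mul_pow hb]
  rw [integral_const_mul,
    integral_prod_mul (fun g : ℝ => √g ^ n) (fun z : ℝ => |z| ^ n),
    integral_sqrt_pow_gammaMeasure ha]

/-- The symmetry is inherited from the Gaussian factor. -/
lemma law_map_neg (ha : 0 < a) : (law 0 a b).map (fun x => -x) = law 0 a b := by
  have := isProbabilityMeasure_gammaMeasure ha one_pos
  rw [law_zero_eq, Measure.map_map (by fun_prop) (by fun_prop)]
  have h : (fun x : ℝ => -x) ∘ (fun p : ℝ × ℝ => √(b * p.1) * p.2)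
      = (fun p : ℝ × ℝ => √(b * p.1) * p.2) ∘ Prod.map id (fun z => -z) := by
    ext p
    simp
  rw [h, ← Measure.map_map (by fun_prop) (by fun_prop),
    ← Measure.map_prod_map _ _ (by fun_prop) (by fun_prop), gaussianReal_map_neg]
  simp

lemma law_singleton_zero (ha : 0 < a) (hb : 0 < b) : law 0 a b {0} = 0 := by
  have := isProbabilityMeasure_gammaMeasure ha one_pos
  have h1 : ∀ᵐ z ∂(gaussianReal 0 1), z ≠ 0 := by
    have := nullSingletonClass_gaussianReal (μ := 0) (v := 1) one_ne_zero
    exact compl_mem_ae_iff.2 (measure_singleton (0 : ℝ))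
  have h2 : ∀ᵐ p ∂((gammaMeasure a 1).prod (gaussianReal 0 1)), 0 < p.1 :=
    Measure.quasiMeasurePreserving_fst.ae (gammaMeasure_ae_pos a)
  have h3 : ∀ᵐ p ∂((gammaMeasure a 1).prod (gaussianReal 0 1)), p.2 ≠ 0 :=
    Measure.quasiMeasurePreserving_snd.ae h1
  rw [law_zero_eq, Measure.map_apply (by fun_prop) (measurableSet_singleton 0)]
  refine measure_mono_null ?_ (h2.and h3)
  rintro p (hp : √(b * p.1) * p.2 = 0) ⟨h, h'⟩
  exact mul_ne_zero (Real.sqrt_ne_zero'.2 (mul_pos hb h)) h' hp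

lemma A_eq (ha : 0 < a) (hb : 0 < b) :
    A a b = √b * (Real.Gamma (a + 1 / 2) / Real.Gamma a * √(2 / Real.pi)) := by
  have h := integral_abs_pow_law ha hb 1
  simpa [A, integral_abs_gaussianReal] using h

lemma V_eq (ha : 0 < a) (hb : 0 < b) : V a b = a * b := by
  have h := integral_abs_pow_law ha hb 2
  simp only [sq_abs, integral_sq_gaussianReal, mul_one, Real.sq_sqrt hb.le, Nat.cast_ofNat,
    div_self (two_ne_zero' ℝ), Real.Gamma_add_one ha.ne'] at h
  rw [V, h, mul_div_cancel_right₀ _ (Real.Gamma_pos_of_pos ha).ne', mul_comm]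

lemma A_pos (ha : 0 < a) (hb : 0 < b) : 0 < A a b := by
  rw [A_eq ha hb]
  have := Real.Gamma_pos_of_pos ha
  have := Real.Gamma_pos_of_pos (show 0 < a + 1 / 2 by linarith)
  have := Real.pi_pos
  positivity

lemma V_pos (ha : 0 < a) (hb : 0 < b) : 0 < V a b := by
  rw [V_eq ha hb]
  positivity

/-- `½ ln V` and `ln A` both contain `½ ln b`, which cancels; this is why `L` determines the shape
by itself. -/
lemma logRatio_A_V (ha : 0 < a) (hb : 0 < b) : logRatio (A a b) (V a b) = L a := by
  have h1 := (Real.Gamma_pos_of_pos ha).ne'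
  have h2 := (Real.Gamma_pos_of_pos (show 0 < a + 1 / 2 by linarith)).ne'
  have h3 := Real.pi_pos
  have h4 : √(2 / Real.pi) ≠ 0 := (Real.sqrt_pos.2 (by positivity)).ne'
  have h5 : √b ≠ 0 := (Real.sqrt_pos.2 hb).ne'
  rw [A_eq ha hb, V_eq ha hb, logRatio, L, Real.log_mul ha.ne' hb.ne',
    Real.log_mul h5 (mul_ne_zero (div_ne_zero h2 h1) h4), Real.log_mul (div_ne_zero h2 h1) h4,
    Real.log_div h2 h1, Real.log_sqrt hb.le, Real.log_sqrt (by positivity),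
    Real.log_div two_ne_zero h3.ne', Real.log_div h3.ne' two_ne_zero]
  ring

lemma shape_A_V (ha : 0 < a) (hb : 0 < b) : shape (A a b) (V a b) = a := by
  rw [shape, logRatio_A_V ha hb, ell_L ha]

lemma scale_A_V (ha : 0 < a) (hb : 0 < b) : scale (A a b) (V a b) = b := by
  rw [scale, shape_A_V ha hb, V_eq ha hb, mul_div_cancel_left₀ _ ha.ne']

lemma infL_lt_logRatio (ha : 0 < a) (hb : 0 < b) : infL < logRatio (A a b) (V a b) := by
  rw [logRatio_A_V ha hb]
  exact infL_lt_L ha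

lemma differentiableAt_shape (ha : 0 < a) (hb : 0 < b) :
    DifferentiableAt ℝ (fun p : ℝ × ℝ => shape p.1 p.2) (A a b, V a b) := by
  have h1 : DifferentiableAt ℝ (fun p : ℝ × ℝ => logRatio p.1 p.2) (A a b, V a b) := by
    have hA : DifferentiableAt ℝ (fun p : ℝ × ℝ => Real.log p.1) (A a b, V a b) :=
      DifferentiableAt.log (by fun_prop) (A_pos ha hb).ne'
    have hV : DifferentiableAt ℝ (fun p : ℝ × ℝ => Real.log p.2) (A a b, V a b) :=
      DifferentiableAt.log (by fun_prop) (V_pos ha hb).ne'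
    unfold logRatio
    fun_prop
  exact DifferentiableAt.comp (g := ell) (A a b, V a b)
    (hasDerivAt_ell (infL_lt_logRatio ha hb)).differentiableAt h1

lemma differentiableAt_scale (ha : 0 < a) (hb : 0 < b) :
    DifferentiableAt ℝ (fun p : ℝ × ℝ => scale p.1 p.2) (A a b, V a b) := by
  have h := (differentiableAt_shape ha hb).fun_inv (by simpa only [shape_A_V ha hb] using ha.ne')
  unfold scale
  simp only [div_eq_mul_inv]
  exact differentiableAt_snd.fun_mul h

/-- Odd functions have integral zero under the centered law. -/
lemma integral_law_eq_zero_of_odd (ha : 0 < a) {f : ℝ → ℝ} (hf : Measurable f)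
    (hodd : ∀ x, f (-x) = -f x) : ∫ x, f x ∂(law 0 a b) = 0 := by
  have h : ∫ x, f x ∂(law 0 a b) = ∫ x, f (-x) ∂(law 0 a b) := by
    conv_lhs => rw [← law_map_neg (b := b) ha]
    exact integral_map (by fun_prop) (by fun_prop)
  simp_rw [hodd, integral_neg] at h
  linarith

lemma memLp_abs_law (ha : 0 < a) (hb : 0 < b) : MemLp (fun x => |x|) 2 (law 0 a b) := by
  rw [memLp_two_iff_integrable_sq (by fun_prop)]
  exact integrable_abs_pow_law ha hb 2

lemma memLp_id_law (ha : 0 < a) (hb : 0 < b) : MemLp (fun x => x) 2 (law 0 a b) := by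
  rw [memLp_two_iff_integrable_sq (by fun_prop)]
  simpa using integrable_abs_pow_law ha hb 2

lemma memLp_sq_law (ha : 0 < a) (hb : 0 < b) : MemLp (fun x => x ^ 2) 2 (law 0 a b) := by
  rw [memLp_two_iff_integrable_sq (by fun_prop)]
  refine (integrable_abs_pow_law ha hb 4).congr (ae_of_all _ fun x => ?_)
  simp only [← pow_mul]
  exact (show Even 4 by decide).pow_abs x

end Law

/-! ### Boundedness and negligibility in probability; the delta method -/

section Stochastic

variable {Ω : Type*} [MeasurableSpace Ω] {P : Measure Ω}

/-- The sequence `U` is bounded in probability. -/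
def BddInProb (P : Measure Ω) (U : ℕ → Ω → ℝ) : Prop :=
  ∀ ε : ℝ, 0 < ε → ∃ M : ℝ, 0 < M ∧ ∀ᶠ n in atTop, P.real {ω | M ≤ |U n ω|} ≤ ε

/-- The sequence `U` tends to zero in probability. -/
def NegligibleInProb (P : Measure Ω) (U : ℕ → Ω → ℝ) : Prop :=
  TendstoInMeasure P U atTop 0

variable {U W : ℕ → Ω → ℝ}

lemma BddInProb.abs (hU : BddInProb P U) : BddInProb P fun n ω => |U n ω| := by
  simpa [BddInProb] using hU

variable [IsFiniteMeasure P]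

lemma negligibleInProb_iff : NegligibleInProb P U ↔
    ∀ ε, 0 < ε → Tendsto (fun n => P.real {ω | ε ≤ |U n ω|}) atTop (𝓝 0) := by
  simp [NegligibleInProb, tendstoInMeasure_iff_measureReal_norm]

lemma NegligibleInProb.mono (hW : NegligibleInProb P W) (h : ∀ n ω, |U n ω| ≤ |W n ω|) :
    NegligibleInProb P U := by
  rw [negligibleInProb_iff] at hW ⊢
  intro ε hε
  refine squeeze_zero (fun _ => measureReal_nonneg) (fun n => ?_) (hW ε hε)
  exact measureReal_mono fun ω hω => le_trans hω (h n ω)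

lemma NegligibleInProb.add (hU : NegligibleInProb P U) (hW : NegligibleInProb P W) :
    NegligibleInProb P fun n ω => U n ω + W n ω := by
  rw [negligibleInProb_iff] at *
  intro ε hε
  have h := (hU (ε / 2) (half_pos hε)).add (hW (ε / 2) (half_pos hε))
  rw [add_zero] at h
  refine squeeze_zero (fun _ => measureReal_nonneg) (fun n => ?_) h
  refine (measureReal_mono fun ω hω => ?_).trans (measureReal_union_le _ _)
  by_contra hc
  simp only [Set.mem_union, Set.mem_ofPred_eq, not_or, not_le] at hc
  have : ε ≤ |U n ω + W n ω| := hω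
  linarith [abs_add_le (U n ω) (W n ω)]

/-- `|U W| ≥ ε` forces `|U| ≥ M` or `|W| ≥ ε / M`. -/
lemma BddInProb.mul_negligible (hU : BddInProb P U) (hW : NegligibleInProb P W) :
    NegligibleInProb P fun n ω => U n ω * W n ω := by
  rw [negligibleInProb_iff] at *
  intro ε hε
  rw [tendsto_order]
  refine ⟨fun u hu => Eventually.of_forall fun n => hu.trans_le measureReal_nonneg,
    fun u hu => ?_⟩
  obtain ⟨M, hM, hMU⟩ := hU (u / 2) (half_pos hu)
  filter_upwards [hMU, (hW (ε / M) (div_pos hε hM)).eventually_lt_const (half_pos hu)]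
    with n h1 h2
  have h3 : P.real {ω | ε ≤ |U n ω * W n ω|} ≤
      P.real {ω | M ≤ |U n ω|} + P.real {ω | ε / M ≤ |W n ω|} := by
    refine (measureReal_mono fun ω hω => ?_).trans (measureReal_union_le _ _)
    by_contra hc
    simp only [Set.mem_union, Set.mem_ofPred_eq, not_or, not_le] at hc
    have h4 : ε ≤ |U n ω * W n ω| := hω
    rw [abs_mul] at h4
    have h5 : |U n ω| * |W n ω| ≤ M * |W n ω| :=
      mul_le_mul_of_nonneg_right hc.1.le (abs_nonneg _)
    have h6 := (lt_div_iff₀' hM).1 hc.2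
    linarith
  linarith

lemma NegligibleInProb.bddInProb (hU : NegligibleInProb P U) : BddInProb P U := by
  rw [negligibleInProb_iff] at hU
  exact fun ε hε => ⟨1, one_pos, ((hU 1 one_pos).eventually_lt_const hε).mono fun _ h => h.le⟩

lemma BddInProb.add (hU : BddInProb P U) (hW : BddInProb P W) :
    BddInProb P fun n ω => U n ω + W n ω := by
  intro ε hε
  obtain ⟨M, hM, hMU⟩ := hU (ε / 2) (half_pos hε)
  obtain ⟨K, hK, hKW⟩ := hW (ε / 2) (half_pos hε)
  refine ⟨M + K, by positivity, ?_⟩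
  filter_upwards [hMU, hKW] with n h1 h2
  have : P.real {ω | M + K ≤ |U n ω + W n ω|} ≤
      P.real {ω | M ≤ |U n ω|} + P.real {ω | K ≤ |W n ω|} := by
    refine (measureReal_mono fun ω hω => ?_).trans (measureReal_union_le _ _)
    by_contra hc
    simp only [Set.mem_union, Set.mem_ofPred_eq, not_or, not_le] at hc
    have : M + K ≤ |U n ω + W n ω| := hω
    linarith [abs_add_le (U n ω) (W n ω)]
  linarith

lemma NegligibleInProb.abs (hU : NegligibleInProb P U) :
    NegligibleInProb P fun n ω => |U n ω| :=
  hU.mono fun _ _ => (abs_abs _).le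

lemma NegligibleInProb.const_mul (c : ℝ) (hU : NegligibleInProb P U) :
    NegligibleInProb P fun n ω => c * U n ω := by
  refine BddInProb.mul_negligible (U := fun _ _ => c) (fun ε hε => ?_) hU
  refine ⟨|c| + 1, by positivity, Eventually.of_forall fun n => ?_⟩
  have : {_ω : Ω | |c| + 1 ≤ |c|} = ∅ := Set.eq_empty_of_forall_notMem fun _ h =>
    absurd (show |c| + 1 ≤ |c| from h) (by linarith)
  rw [this, measureReal_empty]
  exact hε.le

lemma negligibleInProb_of_ae (hU : ∀ n, AEMeasurable (U n) P)
    (h : ∀ᵐ ω ∂P, Tendsto (fun n => U n ω) atTop (𝓝 0)) : NegligibleInProb P U :=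
  tendstoInMeasure_of_tendsto_ae (fun n => (hU n).aestronglyMeasurable) h

/-- A sequence of random vectors whose coordinates are negligible tends to zero in probability. -/
lemma tendstoInMeasure_euclidean {ι : Type*} [Fintype ι] {R : ℕ → Ω → EuclideanSpace ℝ ι}
    (h : ∀ i, NegligibleInProb P fun n ω => R n ω i) : TendstoInMeasure P R atTop 0 := by
  have hs : ∀ s : Finset ι, NegligibleInProb P fun n ω => ∑ i ∈ s, |R n ω i| := by
    classical
    intro s
    induction s using Finset.induction_on with
    | empty =>
      simp only [Finset.sum_empty]
      exact negligibleInProb_of_ae (fun _ => aemeasurable_const) (by simp)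
    | insert i s hi ih =>
      simp only [Finset.sum_insert hi]
      exact (h i).abs.add ih
  have := negligibleInProb_iff.1 (hs Finset.univ)
  rw [tendstoInMeasure_iff_measureReal_norm]
  intro ε hε
  refine squeeze_zero (fun _ => measureReal_nonneg) (fun n => ?_) (this ε hε)
  refine measureReal_mono fun ω hω => ?_
  have h1 : ε ≤ ‖R n ω‖ := by simpa using hω
  have h2 : ‖R n ω‖ ≤ ∑ i, |R n ω i| := by
    rw [EuclideanSpace.norm_eq]
    refine Real.sqrt_le_iff.2 ⟨Finset.sum_nonneg fun _ _ => abs_nonneg _, ?_⟩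
    simp only [Real.norm_eq_abs]
    exact Finset.sum_sq_le_sq_sum_of_nonneg fun _ _ => abs_nonneg _
  exact (h1.trans h2).trans (le_abs_self _)

/-- The **delta method** for a real function of two statistics. -/
lemma delta_method {f : ℝ × ℝ → ℝ} {p q x y : ℝ} {r : ℕ → ℝ} {S T : ℕ → Ω → ℝ}
    (hf : HasFDerivAt f (p • ContinuousLinearMap.fst ℝ ℝ ℝ + q • ContinuousLinearMap.snd ℝ ℝ ℝ)
      (x, y)) (hfm : Measurable f)
    (hSm : ∀ n, AEMeasurable (S n) P) (hTm : ∀ n, AEMeasurable (T n) P)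
    (hS : ∀ᵐ ω ∂P, Tendsto (fun n => S n ω) atTop (𝓝 x))
    (hT : ∀ᵐ ω ∂P, Tendsto (fun n => T n ω) atTop (𝓝 y))
    (hbS : BddInProb P fun n ω => r n * (S n ω - x))
    (hbT : BddInProb P fun n ω => r n * (T n ω - y)) :
    NegligibleInProb P fun n ω => r n * (f (S n ω, T n ω) - f (x, y)) -
      (p * (r n * (S n ω - x)) + q * (r n * (T n ω - y))) := by
  set rem : ℝ × ℝ → ℝ := fun z => f z - f (x, y) - (p * (z.1 - x) + q * (z.2 - y)) with hrem
  set den : ℝ × ℝ → ℝ := fun z => |z.1 - x| + |z.2 - y| with hden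
  have hquot : Tendsto (fun z => rem z / den z) (𝓝 (x, y)) (𝓝 0) := by
    have ho : rem =o[𝓝 (x, y)] fun z => z - (x, y) := by
      refine (hf.isLittleO).congr_left fun z => ?_
      simp [hrem]
    refine (ho.trans_isBigO ?_).tendsto_div_nhds_zero
    refine Asymptotics.isBigO_of_le _ fun z => ?_
    rw [Prod.norm_def, Real.norm_of_nonneg (show 0 ≤ den z by positivity)]
    simp only [Prod.fst_sub, Prod.snd_sub, Real.norm_eq_abs, hden]
    exact max_le (le_add_of_nonneg_right (abs_nonneg _)) (le_add_of_nonneg_left (abs_nonneg _))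
  -- This survives `den z = 0`: then `z = (x, y)`, where the remainder vanishes as well.
  have hz : ∀ z, rem z = den z * (rem z / den z) := by
    intro z
    by_cases h0 : den z = 0
    · have h1 := (add_eq_zero_iff_of_nonneg (abs_nonneg (z.1 - x)) (abs_nonneg (z.2 - y))).1 h0
      have h2 : z.1 = x := sub_eq_zero.1 (abs_eq_zero.1 h1.1)
      have h3 : z.2 = y := sub_eq_zero.1 (abs_eq_zero.1 h1.2)
      have h4 : z = (x, y) := Prod.ext h2 h3
      rw [h0, zero_mul]
      simp [hrem, h4]
    · field_simp
  have hdenm : Measurable den := by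
    rw [hden]
    fun_prop
  have hremm : Measurable rem := by
    rw [hrem]
    fun_prop
  have hneg : NegligibleInProb P fun n ω => rem (S n ω, T n ω) / den (S n ω, T n ω) := by
    refine negligibleInProb_of_ae (fun n => ?_) ?_
    · exact (hremm.div hdenm).comp_aemeasurable ((hSm n).prodMk (hTm n))
    · filter_upwards [hS, hT] with ω h1 h2
      exact hquot.comp (h1.prodMk_nhds h2)
  -- The scaled remainder is `|r n| * den`, bounded in probability, times the quotient, which tends
  -- to zero almost surely.
  refine ((hbS.abs.add hbT.abs).mul_negligible hneg).mono fun n ω => ?_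
  have e : r n * (f (S n ω, T n ω) - f (x, y)) -
      (p * (r n * (S n ω - x)) + q * (r n * (T n ω - y))) = r n * rem (S n ω, T n ω) := by
    simp only [hrem]
    ring
  have e' : |r n * (S n ω - x)| + |r n * (T n ω - y)| = |r n| * den (S n ω, T n ω) := by
    simp only [hden, abs_mul, mul_add]
  rw [e, e', mul_assoc, ← hz, abs_mul, abs_mul, abs_abs]

end Stochastic

/-! ### Empirical means: strong law and central limit theorem -/

lemma measurable_mean {N : ℕ} : Measurable (mean N) := by
  unfold mean
  fun_prop

lemma mean_add_const {N : ℕ} (hN : 0 < N) (x : ℕ → ℝ) (c : ℝ) :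
    mean N (fun k => x k + c) = mean N x + c := by
  have : (N : ℝ) ≠ 0 := by positivity
  simp only [mean, Finset.sum_add_distrib, Finset.sum_const, Finset.card_range, nsmul_eq_mul]
  field_simp

lemma mean_linear_combination (N : ℕ) (p q : ℝ) (x y : ℕ → ℝ) :
    mean N (fun k => p * x k + q * y k) = p * mean N x + q * mean N y := by
  simp only [mean, Finset.sum_add_distrib, ← Finset.mul_sum]
  ring

lemma mean_mono (N : ℕ) {x y : ℕ → ℝ} (h : ∀ k, x k ≤ y k) : mean N x ≤ mean N y :=
  div_le_div_of_nonneg_right (Finset.sum_le_sum fun k _ => h k) (Nat.cast_nonneg N)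

lemma abs_mean_le (N : ℕ) (x : ℕ → ℝ) : |mean N x| ≤ mean N fun k => |x k| := by
  rw [mean, mean, abs_div, Nat.abs_cast]
  exact div_le_div_of_nonneg_right (Finset.abs_sum_le_sum_abs _ _) (Nat.cast_nonneg N)

section Sample

variable {Ω : Type*} [MeasurableSpace Ω] {P : Measure Ω}
  {μ : Measure ℝ} {Y : ℕ → Ω → ℝ}

lemma identDistrib_of_hasLaw (hlaw : ∀ k, HasLaw (Y k) μ P) (k : ℕ) :
    IdentDistrib (Y k) (Y 0) P P :=
  ⟨(hlaw k).aemeasurable, (hlaw 0).aemeasurable, (hlaw k).map_eq.trans (hlaw 0).map_eq.symm⟩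

lemma integral_comp_hasLaw {Y₀ : Ω → ℝ} (hlaw : HasLaw Y₀ μ P) {f : ℝ → ℝ}
    (hf : Measurable f) : ∫ ω, f (Y₀ ω) ∂P = ∫ x, f x ∂μ := by
  rw [← hlaw.map_eq, integral_map hlaw.aemeasurable hf.aestronglyMeasurable]

lemma integrable_comp_hasLaw {Y₀ : Ω → ℝ} (hlaw : HasLaw Y₀ μ P) {f : ℝ → ℝ}
    (hf : Integrable f μ) : Integrable (fun ω => f (Y₀ ω)) P := by
  rw [← hlaw.map_eq] at hf
  exact hf.comp_aemeasurable hlaw.aemeasurable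

lemma memLp_comp_hasLaw {Y₀ : Ω → ℝ} (hlaw : HasLaw Y₀ μ P) {f : ℝ → ℝ}
    (hf : MemLp f 2 μ) : MemLp (fun ω => f (Y₀ ω)) 2 P := by
  rw [← hlaw.map_eq] at hf
  exact hf.comp_of_map hlaw.aemeasurable

lemma tendsto_mean_ae (hindep : iIndepFun Y P) (hlaw : ∀ k, HasLaw (Y k) μ P) {f : ℝ → ℝ}
    (hf : Measurable f) (hfi : Integrable f μ) :
    ∀ᵐ ω ∂P, Tendsto (fun N => mean N fun k => f (Y k ω)) atTop (𝓝 (∫ x, f x ∂μ)) := by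
  rw [← integral_comp_hasLaw (hlaw 0) hf]
  exact strong_law_ae_real (fun k ω => f (Y k ω)) (integrable_comp_hasLaw (hlaw 0) hfi)
    (fun i j hij => (hindep.indepFun hij).comp hf hf)
    fun k => (identDistrib_of_hasLaw hlaw k).comp hf

/-- The Cramér–Wold device: the characteristic function at `t` is that of the projection on `t` at
`1`. -/
lemma charFun_map_eq_charFun_map_inner {E : Type*} [NormedAddCommGroup E] [InnerProductSpace ℝ E]
    [MeasurableSpace E] [BorelSpace E] [SecondCountableTopology E] {T : Ω → E}
    (hT : AEMeasurable T P) (t : E) :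
    charFun (P.map T) t = charFun (P.map fun ω => inner ℝ (T ω) t) 1 := by
  rw [charFun_apply, charFun_apply_real, integral_map hT (by fun_prop),
    integral_map (by fun_prop) (by fun_prop)]
  simp

variable [IsProbabilityMeasure P]

lemma bddInProb_sqrt_mul_mean_sub (hindep : iIndepFun Y P) (hlaw : ∀ k, HasLaw (Y k) μ P)
    {f : ℝ → ℝ} (hf : Measurable f) (hf2 : MemLp f 2 μ) :
    BddInProb P fun N ω => √N * (mean N (fun k => f (Y k ω)) - ∫ x, f x ∂μ) := by
  have hm : ∀ k, MemLp (fun ω => f (Y k ω)) 2 P := fun k => memLp_comp_hasLaw (hlaw k) hf2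
  have hid : ∀ k, IdentDistrib (fun ω => f (Y k ω)) (fun ω => f (Y 0 ω)) P P :=
    fun k => (identDistrib_of_hasLaw hlaw k).comp hf
  set v := Var[fun ω => f (Y 0 ω); P] with hv
  have hv0 : 0 ≤ v := variance_nonneg _ _
  intro ε hε
  have hc : 0 < (v + 1) / ε := div_pos (by linarith) hε
  -- Chebyshev bounds the probability by `v ε / (v + 1) ≤ ε`; the `+ 1` keeps the threshold positive
  -- when `v = 0`.
  refine ⟨√((v + 1) / ε), Real.sqrt_pos.2 hc, ?_⟩
  filter_upwards [eventually_gt_atTop 0] with N hN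
  have hN' : (0 : ℝ) < N := by exact_mod_cast hN
  set S : Ω → ℝ := ∑ k ∈ Finset.range N, fun ω => f (Y k ω) with hS
  have hSL : MemLp S 2 P := memLp_finsetSum' _ fun k _ => hm k
  have hSv : Var[S; P] = N * v := by
    rw [hS, IndepFun.variance_sum (fun k _ => hm k)
      (fun i _ j _ hij => (hindep.indepFun hij).comp hf hf)]
    simp [(hid _).variance_eq, hv]
  have hSe : ∫ ω, S ω ∂P = N * ∫ x, f x ∂μ := by
    simp only [hS, Finset.sum_apply]
    rw [integral_finsetSum _ fun k _ => (hm k).integrable one_le_two]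
    simp [integral_comp_hasLaw (hlaw _) hf]
  have hpos : 0 < √N * √((v + 1) / ε) :=
    mul_pos (Real.sqrt_pos.2 hN') (Real.sqrt_pos.2 hc)
  have hch := meas_ge_le_variance_div_sq hSL hpos
  rw [hSe, hSv, mul_pow, Real.sq_sqrt hN'.le, Real.sq_sqrt hc.le] at hch
  have hle : N * v / (N * ((v + 1) / ε)) ≤ ε := by
    rw [mul_div_mul_left _ _ hN'.ne', div_div_eq_mul_div, div_le_iff₀ (by linarith)]
    nlinarith
  refine ENNReal.toReal_le_of_le_ofReal hε.le ((measure_mono fun ω hω => ?_).trans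
    (hch.trans (ENNReal.ofReal_le_ofReal hle)))
  have h1 : √((v + 1) / ε) ≤ |√N * (mean N (fun k => f (Y k ω)) - ∫ x, f x ∂μ)| := hω
  have h2 : S ω - N * ∫ x, f x ∂μ =
      √N * (√N * (mean N (fun k => f (Y k ω)) - ∫ x, f x ∂μ)) := by
    rw [← mul_assoc, Real.mul_self_sqrt hN'.le, mul_sub, mean, mul_div_cancel₀ _ hN'.ne']
    simp [hS]
  change √N * √((v + 1) / ε) ≤ |S ω - N * ∫ x, f x ∂μ|
  rw [h2, abs_mul (√N), abs_of_nonneg (Real.sqrt_nonneg _)]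
  exact mul_le_mul_of_nonneg_left h1 (Real.sqrt_nonneg _)

section Multivariate

variable {ι : Type*} [Fintype ι] {g : ι → ℝ → ℝ}

open Matrix in
-- This bilinear expansion yields semidefiniteness and also matches the exponents of the
-- multivariate and scalar Gaussian characteristic functions.
lemma dotProduct_covariance_mulVec [IsFiniteMeasure μ] (hg : ∀ i, MemLp (g i) 2 μ) (t : ι → ℝ) :
    t ⬝ᵥ (Matrix.of fun i j => cov[g i, g j; μ]) *ᵥ t = Var[fun x => ∑ i, t i * g i x; μ] := by
  rw [variance_fun_sum fun i => (hg i).const_mul (t i)]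
  simp only [covariance_const_mul_left, covariance_const_mul_right, dotProduct, mulVec, of_apply,
    Finset.mul_sum]
  exact Finset.sum_congr rfl fun i _ => Finset.sum_congr rfl fun j _ => by ring

lemma posSemidef_covariance [IsFiniteMeasure μ] (hg : ∀ i, MemLp (g i) 2 μ) :
    (Matrix.of fun i j => cov[g i, g j; μ]).PosSemidef := by
  refine Matrix.PosSemidef.of_dotProduct_mulVec_nonneg ?_ fun t => ?_
  · ext i j
    simp [covariance_comm (g i)]
  · simp only [star_trivial]
    rw [dotProduct_covariance_mulVec hg]
    exact variance_nonneg _ _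

/-- The multivariate **central limit theorem** for functions of an i.i.d. sequence. -/
theorem tendstoInDistribution_sqrt_smul_mean_sub [DecidableEq ι] [IsProbabilityMeasure μ]
    (hindep : iIndepFun Y P) (hlaw : ∀ k, HasLaw (Y k) μ P) (hgm : ∀ i, Measurable (g i))
    (hg : ∀ i, MemLp (g i) 2 μ) :
    TendstoInDistribution
      (fun (N : ℕ) ω => √N • (WithLp.toLp 2 fun i =>
        mean N (fun k => g i (Y k ω)) - ∫ x, g i x ∂μ : EuclideanSpace ℝ ι))
      atTop (fun z => z) (fun _ => P)
      (multivariateGaussian 0 (Matrix.of fun i j => cov[g i, g j; μ])) := by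
  have hY : ∀ k, AEMeasurable (Y k) P := fun k => (hlaw k).aemeasurable
  have hmeas : ∀ N : ℕ, AEMeasurable (fun ω => √N • (WithLp.toLp 2 fun i =>
      mean N (fun k => g i (Y k ω)) - ∫ x, g i x ∂μ : EuclideanSpace ℝ ι)) P := by
    intro N
    suffices h : AEMeasurable (fun ω => (WithLp.toLp 2 fun i =>
        mean N (fun k => g i (Y k ω)) - ∫ x, g i x ∂μ : EuclideanSpace ℝ ι)) P from
      (measurable_const_smul (√(N : ℝ))).comp_aemeasurable h
    refine (WithLp.measurable_toLp 2 (ι → ℝ)).comp_aemeasurable ?_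
    refine aemeasurable_pi_lambda _ fun i => AEMeasurable.sub_const ?_ _
    exact measurable_mean.comp_aemeasurable
      (aemeasurable_pi_lambda _ fun k => (hgm i).comp_aemeasurable (hY k))
  refine ⟨hmeas, by fun_prop, ?_⟩
  refine ProbabilityMeasure.tendsto_iff_tendsto_charFun.2 fun t => ?_
  simp only [ProbabilityMeasure.coe_mk, Measure.map_id']
  -- The projection on `t` is again a normalized sum of i.i.d. variables, so the scalar theorem
  -- applies to it.
  set f : ℝ → ℝ := fun x => ∑ i, t i * g i x with hf
  have hfm : Measurable f := by
    rw [hf]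
    fun_prop
  have hf2 : MemLp f 2 μ := memLp_finsetSum _ fun i _ => (hg i).const_mul (t i)
  have hfe : ∫ x, f x ∂μ = ∑ i, t i * ∫ x, g i x ∂μ := by
    rw [hf, integral_finsetSum _ fun i _ => ((hg i).integrable one_le_two).const_mul (t i)]
    simp_rw [integral_const_mul]
  have hvar : Var[fun ω => f (Y 0 ω); P] = Var[f; μ] := by
    rw [← (hlaw 0).map_eq, variance_map hfm.aemeasurable (hY 0)]
    rfl
  have hclt := tendstoInDistribution_inv_sqrt_mul_sum_sub (P := P)
    (X := fun k ω => f (Y k ω)) (Y := fun z : ℝ => z)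
    (P' := gaussianReal 0 Var[fun ω => f (Y 0 ω); P].toNNReal)
    ⟨by fun_prop, Measure.map_id⟩ (memLp_comp_hasLaw (hlaw 0) hf2)
    (hindep.comp (fun _ => f) fun _ => hfm)
    (fun k => (identDistrib_of_hasLaw hlaw k).comp hfm)
  have hlim := ProbabilityMeasure.tendsto_iff_tendsto_charFun.1 hclt.tendsto 1
  simp only [ProbabilityMeasure.coe_mk, Measure.map_id'] at hlim
  have e1 : charFun (multivariateGaussian 0 (Matrix.of fun i j => cov[g i, g j; μ])) t =
      charFun (gaussianReal 0 Var[fun ω => f (Y 0 ω); P].toNNReal) 1 := by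
    rw [charFun_multivariateGaussian (posSemidef_covariance hg), dotProduct_covariance_mulVec hg,
      charFun_gaussianReal, hvar]
    simp [hf]
  rw [e1]
  refine hlim.congr fun N => ?_
  rw [charFun_map_eq_charFun_map_inner (hmeas N)]
  congr 2
  funext ω
  rw [integral_comp_hasLaw (hlaw 0) hfm, hfe]
  rcases Nat.eq_zero_or_pos N with rfl | hN
  · simp
  have hN' : (0 : ℝ) < N := by exact_mod_cast hN
  have hs : √(N : ℝ) ≠ 0 := (Real.sqrt_pos.2 hN').ne'
  have e2 : ∑ k ∈ Finset.range N, f (Y k ω) - N * ∑ i, t i * ∫ x, g i x ∂μ =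
      N * ∑ i, t i * (mean N (fun k => g i (Y k ω)) - ∫ x, g i x ∂μ) := by
    simp only [hf, mean, mul_sub, Finset.sum_sub_distrib]
    rw [Finset.sum_comm, sub_left_inj, Finset.mul_sum]
    refine Finset.sum_congr rfl fun i _ => ?_
    rw [← Finset.mul_sum]
    field_simp
  rw [e2, inner_smul_left, PiLp.inner_apply, ← mul_assoc]
  congr 1
  rw [inv_mul_eq_div, div_eq_iff hs]
  simp [Real.mul_self_sqrt hN'.le]

end Multivariate

end Sample

/-! ### The cost of centering by the sample mean -/

lemma mean_sub_const {N : ℕ} (hN : 0 < N) (x : ℕ → ℝ) (c : ℝ) :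
    mean N (fun k => x k - c) = mean N x - c := by
  simpa only [sub_eq_add_neg] using mean_add_const hN x (-c)

lemma center_sub_const {N : ℕ} (hN : 0 < N) (x : ℕ → ℝ) (c : ℝ) :
    center N (fun k => x k - c) = center N x := by
  funext k
  simp only [center, mean_sub_const hN]
  ring

lemma mean_zero (x : ℕ → ℝ) : mean 0 x = 0 := by simp [mean]

/-- Location invariance permits the reduction to `m = 0`. At `N = 0` the mean is `0` and does not
follow shifts, but both sides vanish. -/
lemma madHat_sub_const (N : ℕ) (x : ℕ → ℝ) (c : ℝ) :
    madHat N (fun k => x k - c) = madHat N x := by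
  rcases Nat.eq_zero_or_pos N with rfl | hN
  · simp [madHat, absMoment, mean_zero]
  · rw [madHat, madHat, center_sub_const hN]

lemma varHat_sub_const (N : ℕ) (x : ℕ → ℝ) (c : ℝ) :
    varHat N (fun k => x k - c) = varHat N x := by
  rcases Nat.eq_zero_or_pos N with rfl | hN
  · simp [varHat, sqMoment, mean_zero]
  · rw [varHat, varHat, center_sub_const hN]

lemma varHat_eq (N : ℕ) (x : ℕ → ℝ) : varHat N x = sqMoment N x - mean N x ^ 2 := by
  rcases Nat.eq_zero_or_pos N with rfl | hN
  · simp [varHat, sqMoment, mean_zero]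
  · have e : ∀ k, center N x k ^ 2 = (1 * x k ^ 2 + (-2 * mean N x) * x k) + mean N x ^ 2 :=
      fun k => by
        simp only [center]
        ring
    simp only [varHat, sqMoment, e]
    rw [mean_add_const hN, mean_linear_combination N 1 (-2 * mean N x) (fun k => x k ^ 2) x]
    ring

lemma mean_sub (N : ℕ) (x y : ℕ → ℝ) : mean N (fun k => x k - y k) = mean N x - mean N y := by
  have h := mean_linear_combination N 1 (-1) x y
  have e : ∀ k, 1 * x k + -1 * y k = x k - y k := fun k => by ring
  simp only [e] at h
  linarith

lemma mean_const_le (N : ℕ) {c : ℝ} (hc : 0 ≤ c) : mean N (fun _ => c) ≤ c := by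
  rcases Nat.eq_zero_or_pos N with rfl | hN
  · simpa [mean] using hc
  · have : (N : ℝ) ≠ 0 := by positivity
    simp [mean, this]

/-- This crude bound suffices for consistency, but at scale `√N` it gives only boundedness. -/
lemma abs_madHat_sub_absMoment_le (N : ℕ) (x : ℕ → ℝ) :
    |madHat N x - absMoment N x| ≤ |mean N x| := by
  rw [madHat, absMoment, absMoment, ← mean_sub]
  refine (abs_mean_le N _).trans ((mean_mono N fun k => ?_).trans
    (mean_const_le N (abs_nonneg (mean N x))))
  refine (abs_abs_sub_abs_le_abs_sub _ _).trans_eq ?_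
  simp [center]

/-- As `t` varies, `|y - t|` is affine with slope `-sign y` until `t` reaches `y`. An error can thus
occur only for `|y| ≤ |t|`, and there both terms are at most `|t|`. -/
lemma abs_abs_sub_sub_abs_add_le (y t : ℝ) :
    |(|y - t| - |y|) + t * Real.sign y| ≤ |t| * (2 * if |y| ≤ |t| then 1 else 0) := by
  rcases lt_trichotomy y 0 with h | h | h
  · rw [Real.sign_of_neg h, abs_of_neg h]
    split_ifs with h'
    · have h1 := abs_le.1 ((abs_abs_sub_abs_le_abs_sub (y - t) y).trans_eq
        (by rw [sub_sub_cancel_left, abs_neg]))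
      rw [abs_of_neg h] at h1
      rw [abs_le]
      constructor <;> linarith [le_abs_self t, neg_abs_le t, h1.1, h1.2]
    · have : y - t < 0 := by linarith [neg_abs_le t, not_le.1 h']
      rw [abs_of_neg this]
      simp
  · subst h
    simp only [zero_sub, abs_neg, abs_zero, sub_zero, Real.sign_zero, mul_zero, add_zero, abs_abs,
      abs_nonneg, if_true, mul_one]
    linarith [abs_nonneg t]
  · rw [Real.sign_of_pos h, abs_of_pos h]
    split_ifs with h'
    · have h1 := abs_le.1 ((abs_abs_sub_abs_le_abs_sub (y - t) y).trans_eq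
        (by rw [sub_sub_cancel_left, abs_neg]))
      rw [abs_of_pos h] at h1
      rw [abs_le]
      constructor <;> linarith [le_abs_self t, neg_abs_le t, h1.1, h1.2]
    · have : 0 < y - t := by linarith [le_abs_self t, not_le.1 h']
      rw [abs_of_pos this]
      simp

/-- The fraction of the sample `x 0, …, x (N - 1)` with absolute value at most `δ`. -/
noncomputable def fracNearZero (N : ℕ) (x : ℕ → ℝ) (δ : ℝ) : ℝ :=
  mean N fun k => if |x k| ≤ δ then 1 else 0

lemma fracNearZero_nonneg (N : ℕ) (x : ℕ → ℝ) (δ : ℝ) : 0 ≤ fracNearZero N x δ := by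
  refine div_nonneg (Finset.sum_nonneg fun k _ => ?_) (Nat.cast_nonneg N)
  split_ifs <;> simp

lemma fracNearZero_mono (N : ℕ) (x : ℕ → ℝ) {δ δ' : ℝ} (h : δ ≤ δ') :
    fracNearZero N x δ ≤ fracNearZero N x δ' := by
  refine mean_mono N fun k => ?_
  split_ifs with h1 h2
  · rfl
  · exact absurd (h1.trans h) h2
  · simp
  · rfl

/-- The pointwise bound is averaged. The sign term is kept apart, since it becomes small only
through averaging. -/
lemma abs_madHat_sub_absMoment_le_mul (N : ℕ) (x : ℕ → ℝ) :
    |madHat N x - absMoment N x| ≤ |mean N x| *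
      (|mean N fun k => Real.sign (x k)| + 2 * fracNearZero N x |mean N x|) := by
  set t := mean N x with ht
  have e : madHat N x - absMoment N x =
      mean N (fun k => (|x k - t| - |x k|) + t * Real.sign (x k))
        - t * mean N fun k => Real.sign (x k) := by
    have h := mean_linear_combination N 1 t (fun k => |x k - t| - |x k|) fun k => Real.sign (x k)
    simp only [one_mul] at h
    rw [h, mean_sub]
    simp [madHat, absMoment, center, ht]
  have h1 : |mean N (fun k => (|x k - t| - |x k|) + t * Real.sign (x k))| ≤
      |t| * (2 * fracNearZero N x |t|) := by
    refine (abs_mean_le N _).trans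
      ((mean_mono N fun k => abs_abs_sub_sub_abs_add_le _ _).trans_eq ?_)
    simp only [fracNearZero, mean, ← Finset.mul_sum]
    ring
  rw [e, mul_add, ← abs_mul]
  refine (abs_sub _ _).trans ?_
  rw [add_comm]
  exact add_le_add le_rfl h1

lemma measurable_sign : Measurable Real.sign := by
  unfold Real.sign
  exact Measurable.ite measurableSet_Iio measurable_const
    (Measurable.ite measurableSet_Ioi measurable_const measurable_const)

lemma measurable_fracNearZero (N : ℕ) :
    Measurable fun x : ℕ → ℝ => fracNearZero N x |mean N x| := by
  unfold fracNearZero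
  refine measurable_mean.comp (measurable_pi_lambda _ fun k => ?_)
  refine Measurable.ite (measurableSet_le ?_ ?_) measurable_const measurable_const
  · fun_prop
  · exact measurable_mean.abs

lemma measurable_absMoment (N : ℕ) : Measurable (absMoment N) :=
  measurable_mean.comp (by fun_prop)

lemma measurable_sqMoment (N : ℕ) : Measurable (sqMoment N) :=
  measurable_mean.comp (by fun_prop)

lemma measurable_center (N : ℕ) : Measurable (center N) :=
  measurable_pi_lambda _ fun k => (measurable_pi_apply k).sub measurable_mean

lemma measurable_madHat (N : ℕ) : Measurable (madHat N) :=
  (measurable_absMoment N).comp (measurable_center N)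

lemma measurable_varHat (N : ℕ) : Measurable (varHat N) :=
  (measurable_sqMoment N).comp (measurable_center N)

section Sample

variable {Ω : Type*} [MeasurableSpace Ω] {P : Measure Ω}
  {μ : Measure ℝ} {Y : ℕ → Ω → ℝ}

lemma aemeasurable_sequence (hlaw : ∀ k, HasLaw (Y k) μ P) :
    AEMeasurable (fun ω k => Y k ω) P :=
  aemeasurable_pi_lambda _ fun k => (hlaw k).aemeasurable

/-- The threshold is random, so the strong law does not apply directly. It is applied to the
countably many thresholds `1/(j + 1)`, each of which eventually exceeds `|mean|`; the masses of
these intervals decrease to `μ {0} = 0`. -/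
lemma tendsto_fracNearZero_ae [IsProbabilityMeasure μ] (hindep : iIndepFun Y P)
    (hlaw : ∀ k, HasLaw (Y k) μ P) (hint : Integrable (fun x => x) μ) (hmean : ∫ x, x ∂μ = 0)
    (hzero : μ {0} = 0) :
    ∀ᵐ ω ∂P, Tendsto (fun N => fracNearZero N (fun k => Y k ω) |mean N fun k => Y k ω|) atTop
      (𝓝 0) := by
  set δ : ℕ → ℝ := fun j => 1 / ((j : ℝ) + 1) with hδ
  set s : ℕ → Set ℝ := fun j => {x | |x| ≤ δ j} with hs
  have hsm : ∀ j, MeasurableSet (s j) := fun j => measurableSet_le (by fun_prop) measurable_const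
  have hfrac : ∀ j, ∀ᵐ ω ∂P, Tendsto (fun N => fracNearZero N (fun k => Y k ω) (δ j)) atTop
      (𝓝 (μ.real (s j))) := by
    intro j
    have h := tendsto_mean_ae hindep hlaw (f := (s j).indicator 1)
      (measurable_one.indicator (hsm j)) ((integrable_const (1 : ℝ)).indicator (hsm j))
    rw [integral_indicator_one (hsm j)] at h
    have e : ∀ x, (s j).indicator (1 : ℝ → ℝ) x = if |x| ≤ δ j then 1 else 0 :=
      fun x => Set.indicator_apply _ _ _
    simpa only [e, fracNearZero] using h
  have hlim : Tendsto (fun j => μ.real (s j)) atTop (𝓝 0) := by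
    have h := tendsto_measure_iInter_atTop (μ := μ) (s := s)
      (fun j => (hsm j).nullMeasurableSet)
      (fun i j hij x (hx : |x| ≤ δ j) => hx.trans (Nat.one_div_le_one_div hij))
      ⟨0, measure_ne_top _ _⟩
    have e : ⋂ j, s j = {0} := by
      ext x
      simp only [Set.mem_iInter, Set.mem_singleton_iff]
      refine ⟨fun hx => ?_, fun hx j => ?_⟩
      · have := ge_of_tendsto' tendsto_one_div_add_atTop_nhds_zero_nat
          fun j => show |x| ≤ 1 / ((j : ℝ) + 1) from hx j
        exact abs_nonpos_iff.1 this
      · subst hx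
        change |(0 : ℝ)| ≤ 1 / ((j : ℝ) + 1)
        rw [abs_zero]
        positivity
    rw [e, hzero] at h
    exact (ENNReal.tendsto_toReal_zero_iff fun _ => measure_ne_top _ _).2 h
  have hm := tendsto_mean_ae hindep hlaw measurable_id hint
  simp only [id_eq, hmean] at hm
  filter_upwards [ae_all_iff.2 hfrac, hm] with ω h1 h2
  rw [tendsto_order]
  refine ⟨fun u hu => Eventually.of_forall fun N => hu.trans_le (fracNearZero_nonneg _ _ _),
    fun u hu => ?_⟩
  obtain ⟨j, hj⟩ := (hlim.eventually_lt_const hu).exists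
  have hδj : 0 < δ j := by positivity
  have h2' := h2.abs
  rw [abs_zero] at h2'
  filter_upwards [(h1 j).eventually_lt_const hj, h2'.eventually_lt_const hδj] with N h3 h4
  exact (fracNearZero_mono N _ h4.le).trans_lt h3

variable [IsProbabilityMeasure P]

/-- Centering a sample from a law with mean and median zero by its own mean changes the empirical
absolute moment by `o(N ^ (-1/2))`. -/
lemma negligible_sqrt_mul_madHat_sub [IsProbabilityMeasure μ] (hindep : iIndepFun Y P)
    (hlaw : ∀ k, HasLaw (Y k) μ P) (h2 : MemLp (fun x => x) 2 μ) (hmean : ∫ x, x ∂μ = 0)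
    (hsign : ∫ x, Real.sign x ∂μ = 0) (hzero : μ {0} = 0) :
    NegligibleInProb P fun N ω =>
      √N * (madHat N (fun k => Y k ω) - absMoment N fun k => Y k ω) := by
  have hY := aemeasurable_sequence hlaw
  have hint := h2.integrable one_le_two
  have hb := bddInProb_sqrt_mul_mean_sub hindep hlaw measurable_id h2
  simp only [id_eq, hmean, sub_zero] at hb
  have hsi : Integrable Real.sign μ := by
    refine Integrable.of_bound measurable_sign.aestronglyMeasurable 1 (ae_of_all _ fun x => ?_)
    rcases Real.sign_apply_eq x with h | h | h <;> simp [h]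
  have hs := tendsto_mean_ae hindep hlaw measurable_sign hsi
  have hw : NegligibleInProb P fun N ω => |mean N fun k => Real.sign (Y k ω)| +
      2 * fracNearZero N (fun k => Y k ω) |mean N fun k => Y k ω| := by
    refine negligibleInProb_of_ae (fun N => ?_) ?_
    · have h1 : Measurable fun x : ℕ → ℝ => mean N fun k => Real.sign (x k) :=
        measurable_mean.comp (measurable_pi_lambda _ fun k =>
          measurable_sign.comp (measurable_pi_apply k))
      exact (h1.abs.add ((measurable_fracNearZero N).const_mul 2)).comp_aemeasurable hY
    · filter_upwards [hs, tendsto_fracNearZero_ae hindep hlaw hint hmean hzero] with ω h3 h4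
      rw [hsign] at h3
      simpa using h3.abs.add (h4.const_mul 2)
  -- `√N` times the mean is bounded in probability, and the second factor tends to zero.
  refine (hb.mul_negligible hw).mono fun N ω => ?_
  rw [abs_mul, abs_mul, abs_mul, mul_assoc]
  refine mul_le_mul_of_nonneg_left ?_ (abs_nonneg _)
  exact (abs_madHat_sub_absMoment_le_mul N _).trans
    (mul_le_mul_of_nonneg_left (le_abs_self _) (abs_nonneg _))

/-- The difference is `-mean²`, and `√N mean² = (√N mean) · mean` is a bounded factor times a
negligible one. -/
lemma negligible_sqrt_mul_varHat_sub (hindep : iIndepFun Y P)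
    (hlaw : ∀ k, HasLaw (Y k) μ P) (h2 : MemLp (fun x => x) 2 μ) (hi : Integrable (fun x => x) μ)
    (hmean : ∫ x, x ∂μ = 0) :
    NegligibleInProb P fun N ω =>
      √N * (varHat N (fun k => Y k ω) - sqMoment N fun k => Y k ω) := by
  have hb := bddInProb_sqrt_mul_mean_sub hindep hlaw measurable_id h2
  simp only [id_eq, hmean, sub_zero] at hb
  have hm := tendsto_mean_ae hindep hlaw measurable_id hi
  simp only [id_eq, hmean] at hm
  have hn : NegligibleInProb P fun N ω => mean N fun k => Y k ω :=
    negligibleInProb_of_ae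
      (fun N => measurable_mean.comp_aemeasurable (aemeasurable_sequence hlaw)) hm
  refine (hb.mul_negligible hn).mono fun N ω => le_of_eq ?_
  rw [varHat_eq, ← abs_neg]
  congr 1
  ring

end Sample

/-! ### Linearization of the estimators and its covariances -/

lemma hasFDerivAt_of_partial_deriv {f : ℝ × ℝ → ℝ} {x y : ℝ} (hf : DifferentiableAt ℝ f (x, y)) :
    HasFDerivAt f (deriv (fun u => f (u, y)) x • ContinuousLinearMap.fst ℝ ℝ ℝ +
      deriv (fun v => f (x, v)) y • ContinuousLinearMap.snd ℝ ℝ ℝ) (x, y) := by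
  have h1 : deriv (fun u => f (u, y)) x = fderiv ℝ f (x, y) (1, 0) :=
    (hf.hasFDerivAt.comp_hasDerivAt x ((hasDerivAt_id x).prodMk (hasDerivAt_const x y))).deriv
  have h2 : deriv (fun v => f (x, v)) y = fderiv ℝ f (x, y) (0, 1) :=
    (hf.hasFDerivAt.comp_hasDerivAt y ((hasDerivAt_const y x).prodMk (hasDerivAt_id y))).deriv
  convert hf.hasFDerivAt using 1
  rw [h1, h2]
  ext <;> simp

/-- The linearization of `Ψ` at `(A, V)`, evaluated at the moment functions `(|x|, x ^ 2)`. -/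
noncomputable def influence (a b : ℝ) (i : Fin 2) (x : ℝ) : ℝ :=
  jacobian a b i 0 * |x| + jacobian a b i 1 * x ^ 2

/-- The linearization of the joint estimator of location, shape and scale. -/
noncomputable def jointInfluence (a b : ℝ) : Fin 3 → ℝ → ℝ :=
  ![fun x => x, influence a b 0, influence a b 1]

lemma measurable_influence (a b : ℝ) (i : Fin 2) : Measurable (influence a b i) := by
  unfold influence
  fun_prop

lemma measurable_aHat' (N : ℕ) : Measurable (aHat' N) :=
  measurable_shape.comp ((measurable_absMoment N).prodMk (measurable_sqMoment N))

lemma measurable_bHat' (N : ℕ) : Measurable (bHat' N) :=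
  measurable_scale.comp ((measurable_absMoment N).prodMk (measurable_sqMoment N))

lemma measurable_aHat (N : ℕ) : Measurable (aHat N) :=
  measurable_shape.comp ((measurable_madHat N).prodMk (measurable_varHat N))

lemma measurable_bHat (N : ℕ) : Measurable (bHat N) :=
  measurable_scale.comp ((measurable_madHat N).prodMk (measurable_varHat N))

lemma measurable_const_smul_toLp {α ι : Type*} [MeasurableSpace α] [Fintype ι] (c : ℝ)
    {f : α → ι → ℝ} (hf : ∀ i, Measurable fun x => f x i) :
    Measurable fun x => c • (WithLp.toLp 2 (f x) : EuclideanSpace ℝ ι) :=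
  (measurable_const_smul c).comp
    ((WithLp.measurable_toLp 2 (ι → ℝ)).comp (measurable_pi_lambda _ hf))

section Law

variable {a b : ℝ}

lemma memLp_influence (ha : 0 < a) (hb : 0 < b) (i : Fin 2) :
    MemLp (influence a b i) 2 (law 0 a b) :=
  ((memLp_abs_law ha hb).const_mul _).add ((memLp_sq_law ha hb).const_mul _)

lemma measurable_jointInfluence (a b : ℝ) (i : Fin 3) : Measurable (jointInfluence a b i) := by
  fin_cases i
  · exact measurable_id
  · exact measurable_influence a b 0
  · exact measurable_influence a b 1

lemma memLp_jointInfluence (ha : 0 < a) (hb : 0 < b) (i : Fin 3) :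
    MemLp (jointInfluence a b i) 2 (law 0 a b) := by
  fin_cases i
  · exact memLp_id_law ha hb
  · exact memLp_influence ha hb 0
  · exact memLp_influence ha hb 1

lemma integral_influence (ha : 0 < a) (hb : 0 < b) (i : Fin 2) :
    ∫ x, influence a b i x ∂(law 0 a b) =
      jacobian a b i 0 * A a b + jacobian a b i 1 * V a b := by
  have := isProbabilityMeasure_law 0 b ha
  unfold influence
  rw [integral_add (((memLp_abs_law ha hb).integrable one_le_two).const_mul _)
    (((memLp_sq_law ha hb).integrable one_le_two).const_mul _), integral_const_mul,
    integral_const_mul]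
  rfl

/-- Bilinearity: `J C Jᵀ` is the covariance of the image under `J` of `(|X|, X²)`. -/
lemma limitCov_eq (ha : 0 < a) (hb : 0 < b) :
    limitCov a b =
      Matrix.of fun i j => cov[influence a b i, influence a b j; law 0 a b] := by
  have := isProbabilityMeasure_law 0 b ha
  ext i j
  have hm : ∀ k : Fin 2, MemLp (fun x : ℝ => ![|x|, x ^ 2] k) 2 (law 0 a b) := by
    intro k
    fin_cases k
    · exact memLp_abs_law ha hb
    · exact memLp_sq_law ha hb
  have e : ∀ i, influence a b i =
      fun x => ∑ k, jacobian a b i k * ![|x|, x ^ 2] k := by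
    intro i
    funext x
    simp [influence]
  rw [Matrix.of_apply, e i, e j, covariance_fun_sum_fun_sum (fun k => (hm k).const_mul _)
    fun k => (hm k).const_mul _]
  simp only [covariance_const_mul_left, covariance_const_mul_right, limitCov, Matrix.mul_apply,
    momentCov, Matrix.of_apply, Matrix.transpose_apply, Finset.sum_mul]
  rw [Finset.sum_comm]
  exact Finset.sum_congr rfl fun k _ => Finset.sum_congr rfl fun l _ => by ring

lemma posSemidef_limitCov (ha : 0 < a) (hb : 0 < b) : (limitCov a b).PosSemidef := by
  have := isProbabilityMeasure_law 0 b ha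
  rw [limitCov_eq ha hb]
  exact posSemidef_covariance (memLp_influence ha hb)

lemma integral_id_law (ha : 0 < a) : ∫ x, x ∂(law 0 a b) = 0 :=
  integral_law_eq_zero_of_odd ha measurable_id fun _ => rfl

/-- An odd function times an even one is odd. This produces the zero blocks of the limit. -/
lemma covariance_id_influence (ha : 0 < a) (i : Fin 2) :
    cov[fun x => x, influence a b i; law 0 a b] = 0 := by
  have := measurable_influence a b i
  unfold covariance
  rw [integral_id_law ha]
  refine integral_law_eq_zero_of_odd ha (by fun_prop) fun x => ?_
  simp only [influence, abs_neg, neg_sq, sub_zero]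
  ring

lemma covariance_id_id (ha : 0 < a) (hb : 0 < b) :
    cov[fun x => x, fun x => x; law 0 a b] = a * b := by
  unfold covariance
  rw [integral_id_law ha, ← V_eq ha hb, V]
  simp only [sub_zero, sq]

lemma blockDiag_limitCov_eq (ha : 0 < a) (hb : 0 < b) :
    blockDiag (a * b) (limitCov a b) =
      Matrix.of fun i j : Fin 3 => cov[jointInfluence a b i, jointInfluence a b j; law 0 a b] := by
  rw [limitCov_eq ha hb]
  ext i j
  fin_cases i <;> fin_cases j <;>
    simp [blockDiag, jointInfluence, covariance_id_influence ha, covariance_id_id ha hb,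
      covariance_comm (influence a b _) fun x => x]

end Law

/-! ### Limit theorems for location zero -/

section Sample

variable {Ω : Type*} [MeasurableSpace Ω] {P : Measure Ω}
  {a b : ℝ} {Y : ℕ → Ω → ℝ}

lemma tendsto_absMoment_ae (ha : 0 < a) (hb : 0 < b) (hindep : iIndepFun Y P)
    (hlaw : ∀ k, HasLaw (Y k) (law 0 a b) P) :
    ∀ᵐ ω ∂P, Tendsto (fun N => absMoment N fun k => Y k ω) atTop (𝓝 (A a b)) :=
  have := isProbabilityMeasure_law 0 b ha
  tendsto_mean_ae hindep hlaw (by fun_prop) ((memLp_abs_law ha hb).integrable one_le_two)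

lemma tendsto_sqMoment_ae (ha : 0 < a) (hb : 0 < b) (hindep : iIndepFun Y P)
    (hlaw : ∀ k, HasLaw (Y k) (law 0 a b) P) :
    ∀ᵐ ω ∂P, Tendsto (fun N => sqMoment N fun k => Y k ω) atTop (𝓝 (V a b)) :=
  have := isProbabilityMeasure_law 0 b ha
  tendsto_mean_ae hindep hlaw (by fun_prop) ((memLp_sq_law ha hb).integrable one_le_two)

lemma tendsto_mean_law_ae (ha : 0 < a) (hb : 0 < b) (hindep : iIndepFun Y P)
    (hlaw : ∀ k, HasLaw (Y k) (law 0 a b) P) :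
    ∀ᵐ ω ∂P, Tendsto (fun N => mean N fun k => Y k ω) atTop (𝓝 0) := by
  have := isProbabilityMeasure_law 0 b ha
  have h := tendsto_mean_ae hindep hlaw measurable_id ((memLp_id_law ha hb).integrable one_le_two)
  simpa only [id_eq, integral_id_law ha] using h

lemma tendsto_madHat_ae (ha : 0 < a) (hb : 0 < b) (hindep : iIndepFun Y P)
    (hlaw : ∀ k, HasLaw (Y k) (law 0 a b) P) :
    ∀ᵐ ω ∂P, Tendsto (fun N => madHat N fun k => Y k ω) atTop (𝓝 (A a b)) := by
  filter_upwards [tendsto_absMoment_ae ha hb hindep hlaw, tendsto_mean_law_ae ha hb hindep hlaw]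
    with ω h1 h2
  have h3 : Tendsto (fun N => madHat N (fun k => Y k ω) - absMoment N fun k => Y k ω) atTop
      (𝓝 0) :=
    squeeze_zero_norm (fun N => abs_madHat_sub_absMoment_le N _) (by simpa using h2.abs)
  simpa using h3.add h1

lemma tendsto_varHat_ae (ha : 0 < a) (hb : 0 < b) (hindep : iIndepFun Y P)
    (hlaw : ∀ k, HasLaw (Y k) (law 0 a b) P) :
    ∀ᵐ ω ∂P, Tendsto (fun N => varHat N fun k => Y k ω) atTop (𝓝 (V a b)) := by
  filter_upwards [tendsto_sqMoment_ae ha hb hindep hlaw, tendsto_mean_law_ae ha hb hindep hlaw]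
    with ω h1 h2
  simp only [varHat_eq]
  simpa using h1.sub (h2.pow 2)

lemma tendsto_logRatio (ha : 0 < a) (hb : 0 < b) {x y : ℕ → ℝ}
    (hx : Tendsto x atTop (𝓝 (A a b))) (hy : Tendsto y atTop (𝓝 (V a b))) :
    Tendsto (fun N => logRatio (x N) (y N)) atTop (𝓝 (logRatio (A a b) (V a b))) :=
  ((hy.log (V_pos ha hb).ne').const_mul _).sub (hx.log (A_pos ha hb).ne')

variable [IsProbabilityMeasure P]

/-- Linearization of a differentiable function of statistics which are asymptotically equivalent to
the empirical absolute and second moments. -/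
lemma negligible_sqrt_mul_sub_influence (ha : 0 < a) (hb : 0 < b) (hindep : iIndepFun Y P)
    (hlaw : ∀ k, HasLaw (Y k) (law 0 a b) P) {S T : ℕ → (ℕ → ℝ) → ℝ}
    (hSm : ∀ N, Measurable (S N)) (hTm : ∀ N, Measurable (T N))
    (hS : ∀ᵐ ω ∂P, Tendsto (fun N => S N fun k => Y k ω) atTop (𝓝 (A a b)))
    (hT : ∀ᵐ ω ∂P, Tendsto (fun N => T N fun k => Y k ω) atTop (𝓝 (V a b)))
    (hS' : NegligibleInProb P fun N ω =>
      √N * (S N (fun k => Y k ω) - absMoment N fun k => Y k ω))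
    (hT' : NegligibleInProb P fun N ω =>
      √N * (T N (fun k => Y k ω) - sqMoment N fun k => Y k ω))
    {f : ℝ × ℝ → ℝ} (hfm : Measurable f) (hf : DifferentiableAt ℝ f (A a b, V a b))
    (i : Fin 2) (hi0 : jacobian a b i 0 = deriv (fun u => f (u, V a b)) (A a b))
    (hi1 : jacobian a b i 1 = deriv (fun v => f (A a b, v)) (V a b)) :
    NegligibleInProb P fun N ω =>
      √N * (f (S N fun k => Y k ω, T N fun k => Y k ω) - f (A a b, V a b)) -
        √N * (mean N (fun k => influence a b i (Y k ω)) -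
          ∫ x, influence a b i x ∂(law 0 a b)) := by
  have hY := aemeasurable_sequence hlaw
  have hb1 := bddInProb_sqrt_mul_mean_sub hindep hlaw (by fun_prop) (memLp_abs_law ha hb)
  have hb2 := bddInProb_sqrt_mul_mean_sub hindep hlaw (by fun_prop) (memLp_sq_law ha hb)
  -- Split as the error of replacing `S` by the raw moment, plus the fluctuation of that moment.
  have hbS : BddInProb P fun N ω => √N * (S N (fun k => Y k ω) - A a b) := by
    convert hS'.bddInProb.add hb1 using 3
    simp only [absMoment, A]
    ring
  have hbT : BddInProb P fun N ω => √N * (T N (fun k => Y k ω) - V a b) := by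
    convert hT'.bddInProb.add hb2 using 3
    simp only [sqMoment, V]
    ring
  have hd := hasFDerivAt_of_partial_deriv hf
  rw [← hi0, ← hi1] at hd
  have h := delta_method hd hfm (fun N => (hSm N).comp_aemeasurable hY)
    (fun N => (hTm N).comp_aemeasurable hY) hS hT hbS hbT
  -- The delta method linearizes in `S` and `T`; replacing them by raw moments adds the negligible
  -- errors weighted by the Jacobian entries.
  convert h.add ((hS'.const_mul (jacobian a b i 0)).add (hT'.const_mul (jacobian a b i 1)))
    using 3
  rw [integral_influence ha hb]
  simp only [influence]
  rw [mean_linear_combination]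
  simp only [absMoment, sqMoment, Function.comp_apply]
  ring

/-- Asymptotic normality of the estimators of `(a, b)` for known location. -/
lemma tendstoInDistribution_known_location (ha : 0 < a) (hb : 0 < b) (hindep : iIndepFun Y P)
    (hlaw : ∀ k, HasLaw (Y k) (law 0 a b) P) :
    TendstoInDistribution
      (fun (N : ℕ) (ω : Ω) => √N • (!₂[aHat' N (fun k => Y k ω) - a,
        bHat' N (fun k => Y k ω) - b] : EuclideanSpace ℝ (Fin 2)))
      atTop (fun z => z) (fun _ => P) (multivariateGaussian 0 (limitCov a b)) := by
  have := isProbabilityMeasure_law 0 b ha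
  have hY := aemeasurable_sequence hlaw
  have hclt := tendstoInDistribution_sqrt_smul_mean_sub hindep hlaw
    (measurable_influence a b) (memLp_influence ha hb)
  rw [← limitCov_eq ha hb] at hclt
  have hzero : ∀ W : ℕ → Ω → ℝ, NegligibleInProb P fun N ω => √N * (W N ω - W N ω) := fun W => by
    simp only [sub_self, mul_zero]
    exact negligibleInProb_of_ae (fun _ => aemeasurable_const) (by simp)
  have hlin := fun f => negligible_sqrt_mul_sub_influence (f := f) ha hb hindep hlaw
    measurable_absMoment measurable_sqMoment
    (tendsto_absMoment_ae ha hb hindep hlaw) (tendsto_sqMoment_ae ha hb hindep hlaw)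
    (hzero _) (hzero _)
  have h0 := hlin _ measurable_shape (differentiableAt_shape ha hb) 0 rfl rfl
  have h1 := hlin _ measurable_scale (differentiableAt_scale ha hb) 1 rfl rfl
  -- Slutsky: the estimators differ from their linear part by a term that is negligible in every
  -- coordinate.
  refine tendstoInDistribution_of_tendstoInMeasure_sub _ _ hclt
    (tendstoInMeasure_euclidean fun i => ?_) fun N => ?_
  · fin_cases i
    · simpa [Function.uncurry, shape_A_V ha hb, aHat'] using h0
    · simpa [Function.uncurry, scale_A_V ha hb, bHat'] using h1
  · refine Measurable.comp_aemeasurable (g := fun x : ℕ → ℝ =>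
      √N • (!₂[aHat' N x - a, bHat' N x - b] : EuclideanSpace ℝ (Fin 2)))
      (measurable_const_smul_toLp _ fun i => ?_) hY
    fin_cases i
    · exact (measurable_aHat' N).sub_const a
    · exact (measurable_bHat' N).sub_const b

/-- Joint asymptotic normality of the estimators for unknown location. -/
lemma tendstoInDistribution_unknown_location (ha : 0 < a) (hb : 0 < b) (hindep : iIndepFun Y P)
    (hlaw : ∀ k, HasLaw (Y k) (law 0 a b) P) :
    TendstoInDistribution
      (fun (N : ℕ) (ω : Ω) => √N • (!₂[mean N (fun k => Y k ω), aHat N (fun k => Y k ω) - a,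
        bHat N (fun k => Y k ω) - b] : EuclideanSpace ℝ (Fin 3)))
      atTop (fun z => z) (fun _ => P)
      (multivariateGaussian 0 (blockDiag (a * b) (limitCov a b))) := by
  have := isProbabilityMeasure_law 0 b ha
  have hY := aemeasurable_sequence hlaw
  have hclt := tendstoInDistribution_sqrt_smul_mean_sub hindep hlaw
    (measurable_jointInfluence a b) (memLp_jointInfluence ha hb)
  rw [← blockDiag_limitCov_eq ha hb] at hclt
  have hlin := fun f => negligible_sqrt_mul_sub_influence (f := f) ha hb hindep hlaw
    measurable_madHat measurable_varHat
    (tendsto_madHat_ae ha hb hindep hlaw) (tendsto_varHat_ae ha hb hindep hlaw)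
    (negligible_sqrt_mul_madHat_sub hindep hlaw (memLp_id_law ha hb) (integral_id_law ha)
      (integral_law_eq_zero_of_odd ha measurable_sign fun _ => Real.sign_neg)
      (law_singleton_zero ha hb))
    (negligible_sqrt_mul_varHat_sub hindep hlaw (memLp_id_law ha hb)
      ((memLp_id_law ha hb).integrable one_le_two) (integral_id_law ha))
  have h0 := hlin _ measurable_shape (differentiableAt_shape ha hb) 0 rfl rfl
  have h1 := hlin _ measurable_scale (differentiableAt_scale ha hb) 1 rfl rfl
  refine tendstoInDistribution_of_tendstoInMeasure_sub _ _ hclt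
    (tendstoInMeasure_euclidean fun i => ?_) fun N => ?_
  · fin_cases i
    -- The sample mean is already linear, so its remainder is identically zero.
    · have hz : NegligibleInProb P fun (_ : ℕ) (_ : Ω) => (0 : ℝ) :=
        negligibleInProb_of_ae (fun _ => aemeasurable_const) (by simp)
      simpa [jointInfluence, integral_id_law ha] using hz
    · simpa [jointInfluence, Function.uncurry, shape_A_V ha hb, aHat] using h0
    · simpa [jointInfluence, Function.uncurry, scale_A_V ha hb, bHat] using h1
  · refine Measurable.comp_aemeasurable (g := fun x : ℕ → ℝ =>
      √N • (!₂[mean N x, aHat N x - a, bHat N x - b] : EuclideanSpace ℝ (Fin 3)))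
      (measurable_const_smul_toLp _ fun i => ?_) hY
    fin_cases i
    · exact measurable_mean
    · exact (measurable_aHat N).sub_const a
    · exact (measurable_bHat N).sub_const b

end Sample

end SVG

/-! ### Reduction to location zero -/

theorem theorem8 {Ω : Type*} [MeasurableSpace Ω] (P : Measure Ω) [IsProbabilityMeasure P]
    (m a b : ℝ) (ha : 0 < a) (hb : 0 < b)
    (X : ℕ → Ω → ℝ) (hindep : iIndepFun X P) (hlaw : ∀ k, HasLaw (X k) (SVG.law m a b) P) :
    -- almost surely the estimators are well defined for all large sample sizes
    (∀ᵐ ω ∂P, ∀ᶠ N : ℕ in atTop,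
      1 / 2 * Real.log (Real.pi / 2) <
        SVG.logRatio (SVG.madHat N (fun k => X k ω)) (SVG.varHat N (fun k => X k ω))) ∧
    -- consistency
    (∀ᵐ ω ∂P,
      Tendsto (fun N : ℕ => SVG.mean N (fun k => X k ω)) atTop (𝓝 m) ∧
      Tendsto (fun N : ℕ => SVG.aHat N (fun k => X k ω)) atTop (𝓝 a) ∧
      Tendsto (fun N : ℕ => SVG.bHat N (fun k => X k ω)) atTop (𝓝 b)) ∧
    -- `Σ` is the limiting covariance matrix of the estimators for known location
    (SVG.limitCov a b).PosSemidef ∧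
    TendstoInDistribution
      (fun (N : ℕ) (ω : Ω) => Real.sqrt N •
        (!₂[SVG.aHat' N (fun k => X k ω - m) - a,
            SVG.bHat' N (fun k => X k ω - m) - b] : EuclideanSpace ℝ (Fin 2)))
      atTop (fun z => z) (fun _ => P)
      (multivariateGaussian (0 : EuclideanSpace ℝ (Fin 2)) (SVG.limitCov a b)) ∧
    -- joint asymptotic normality with limiting covariance matrix `diag(ab, Σ)`
    TendstoInDistribution
      (fun (N : ℕ) (ω : Ω) => Real.sqrt N •
        (!₂[SVG.mean N (fun k => X k ω) - m,
            SVG.aHat N (fun k => X k ω) - a,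
            SVG.bHat N (fun k => X k ω) - b] : EuclideanSpace ℝ (Fin 3)))
      atTop (fun z => z) (fun _ => P)
      (multivariateGaussian (0 : EuclideanSpace ℝ (Fin 3))
        (SVG.blockDiag (a * b) (SVG.limitCov a b))) := by
  set Y : ℕ → Ω → ℝ := fun k ω => X k ω - m with hYdef
  have hYindep : iIndepFun Y P := hindep.comp (fun _ x => x - m) fun _ => by fun_prop
  have hYlaw : ∀ k, HasLaw (Y k) (SVG.law 0 a b) P := fun k => by
    have hX := (hlaw k).aemeasurable
    refine ⟨by fun_prop, ?_⟩
    rw [← SVG.law_map_sub m a b, ← (hlaw k).map_eq,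
      AEMeasurable.map_map_of_aemeasurable (by fun_prop) hX]
    rfl
  have hmad : ∀ N ω, SVG.madHat N (fun k => X k ω) = SVG.madHat N fun k => Y k ω :=
    fun N ω => (SVG.madHat_sub_const N _ m).symm
  have hvar : ∀ N ω, SVG.varHat N (fun k => X k ω) = SVG.varHat N fun k => Y k ω :=
    fun N ω => (SVG.varHat_sub_const N _ m).symm
  have haHat : ∀ N ω, SVG.aHat N (fun k => X k ω) = SVG.aHat N fun k => Y k ω :=
    fun N ω => by rw [SVG.aHat, SVG.aHat, hmad, hvar]
  have hbHat : ∀ N ω, SVG.bHat N (fun k => X k ω) = SVG.bHat N fun k => Y k ω :=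
    fun N ω => by rw [SVG.bHat, SVG.bHat, hmad, hvar]
  have hratio : ∀ᵐ ω ∂P, Tendsto (fun N => SVG.logRatio (SVG.madHat N fun k => Y k ω)
      (SVG.varHat N fun k => Y k ω)) atTop (𝓝 (SVG.logRatio (SVG.A a b) (SVG.V a b))) := by
    filter_upwards [SVG.tendsto_madHat_ae ha hb hYindep hYlaw,
      SVG.tendsto_varHat_ae ha hb hYindep hYlaw] with ω h1 h2
    exact SVG.tendsto_logRatio ha hb h1 h2
  refine ⟨?_, ?_, SVG.posSemidef_limitCov ha hb,
    SVG.tendstoInDistribution_known_location ha hb hYindep hYlaw, ?_⟩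
  · filter_upwards [hratio] with ω h
    simp only [hmad, hvar]
    exact h.eventually_const_lt (SVG.infL_lt_logRatio ha hb)
  · filter_upwards [hratio, SVG.tendsto_varHat_ae ha hb hYindep hYlaw,
      SVG.tendsto_mean_law_ae ha hb hYindep hYlaw] with ω h1 h2 h3
    have h4 : Tendsto (fun N => SVG.aHat N fun k => Y k ω) atTop (𝓝 a) := by
      have h := (SVG.continuousAt_ell (SVG.infL_lt_logRatio ha hb)).tendsto.comp h1
      rwa [SVG.logRatio_A_V ha hb, SVG.ell_L ha] at h
    simp only [haHat, hbHat]
    refine ⟨?_, h4, ?_⟩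
    · have h5 := h3.add_const m
      rw [zero_add] at h5
      refine h5.congr' ?_
      filter_upwards [eventually_gt_atTop 0] with N hN
      rw [hYdef, SVG.mean_sub_const hN, sub_add_cancel]
    · have h := h2.div h4 ha.ne'
      rwa [SVG.V_eq ha hb, mul_div_cancel_left₀ _ ha.ne'] at h
  · convert SVG.tendstoInDistribution_unknown_location ha hb hYindep hYlaw using 3 with N ω
    -- At `N = 0` the means of `X` and `Y` need not differ by `m`, but the factor `√0` annihilates
    -- both vectors.
    rcases Nat.eq_zero_or_pos N with rfl | hN
    · simp
    · rw [haHat, hbHat, hYdef, SVG.mean_sub_const hN]
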